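/- For $i=1,\dots,n$ let $\mathcal X_i$ be a complete separable metric space with its Borel $\sigma$-field, $\mu_i$ a probability measure on $\mathcal X_i$, $(\mathcal E_i,\mathbb D(\mathcal E_i))$ a (symmetric) Dirichlet form on $L^2(\mu_i)$, $c_i:\mathcal X_i^2\to[0,\infty]$ a lower semicontinuous cost with $c_i(x,x)=0$ for all $x$, and $\alpha_i:[0,\infty)\to[0,\infty]$ a nondecreasing, left continuous, convex function with $\alpha_i(0)=0$. For a cost $c$ on $\mathcal X$ and probability measures $\nu,\mu$ on $\mathcal X$, let $T_c(\nu,\mu)=\inf_\pi\int c\,d\pi\in[0,\infty]$, the infimum being over all couplings $\pi$ of $\nu$ and $\mu$. For a form $\mathcal E$ with domain $\mathbb D(\mathcal E)\subset L^2(\mu)$, the Fisher–Donsker–Varadhan information is $I_{\mathcal E}(\nu|\mu)=\mathcal E(\sqrt f,\sqrt f)$ if $\nu=f\mu$ with $\sqrt f\in\mathbb D(\mathcal E)$, and $I_{\mathcal E}(\nu|\mu)=+\infty$ otherwise; write $I_i=I_{\mathcal E_i}$. A nondecreasing function $\alpha$ on $[0,\infty)$ is extended by $\alpha(\infty)=\lim_{r\to\infty}\alpha(r)$.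 Suppose that for every $i$ $$\alpha_i(T_{c_i}(\nu,\mu_i))\le I_i(\nu|\mu_i)\qquad\text{for all probability measures }\nu\text{ on }\mathcal X_i .$$ On $\mathcal X^{(n)}=\prod_{i=1}^n\mathcal X_i$ put $\mu=\prod_{i=1}^n\mu_i$ and $(\oplus_ic_i)(x,y)=\sum_{i=1}^nc_i(x_i,y_i)$, and for $r\ge0$ let $$(\alpha_1\Box\cdots\Box\alpha_n)(r)=\inf\Big\{\sum_{i=1}^n\alpha_i(r_i):\ r_i\ge0,\ \sum_{i=1}^nr_i=r\Big\}.$$ For a function $g$ on $\mathcal X^{(n)}$, let $g_i$ denote $g$ as a function of its $i$-th variable, the other variables $\hat x_i$ being fixed. Define the sum form $\oplus_i\mathcal E_i$ by $$\mathbb D(\oplus_i\mathcal E_i)=\Big\{g\in L^2(\mu):\ g_i\in\mathbb D(\mathcal E_i)\text{ for }\mu\text{-a.e. }\hat x_i\text{ and every }i,\ \int\sum_{i=1}^n\mathcal E_i(g_i,g_i)\,d\mu<\infty\Big\},$$ $$(\oplus_i\mathcal E_i)(g,g)=\int\sum_{i=1}^n\mathcal E_i(g_i,g_i)\,d\mu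 .$$ Then $$(\alpha_1\Box\cdots\Box\alpha_n)\big(T_{\oplus_ic_i}(\nu,\mu)\big)\le I_{\oplus_i\mathcal E_i}(\nu|\mu)\qquad\text{for all probability measures }\nu\text{ on }\mathcal X^{(n)} .$$ -/

import Mathlib

open MeasureTheory Filter Topology
open scoped ENNReal NNReal

/-- The transportation cost `T_c(ν, μ)`: infimum of `∬ c dπ` over all couplings `π` of `ν` and `μ`
(first marginal `ν`, second marginal `μ`), with values in `[0, ∞]`. -/
noncomputable def transportCost {X : Type*} [MeasurableSpace X] (c : X → X → ℝ≥0∞)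
    (ν μ : Measure X) : ℝ≥0∞ :=
  ⨅ (π : Measure (X × X)) (_ : π.map Prod.fst = ν) (_ : π.map Prod.snd = μ),
    ∫⁻ p, c p.1 p.2 ∂π

/-- The sum cost `(⊕ᵢ cᵢ)(x, y) = ∑ᵢ cᵢ(xᵢ, yᵢ)`. -/
noncomputable def sumCost {n : ℕ} {X : Fin n → Type*} (c : ∀ i, X i → X i → ℝ≥0∞)
    (x y : ∀ i, X i) : ℝ≥0∞ :=
  ∑ i, c i (x i) (y i)

/-- The inf-convolution
`(α₁ □ ⋯ □ αₙ)(r) = inf { ∑ᵢ αᵢ(rᵢ) ; rᵢ ≥ 0, ∑ᵢ rᵢ = r }`. -/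
noncomputable def infConv {n : ℕ} (α : Fin n → ℝ≥0 → ℝ≥0∞) (r : ℝ≥0) : ℝ≥0∞ :=
  ⨅ (s : Fin n → ℝ≥0) (_ : ∑ i, s i = r), ∑ i, α i (s i)

/-- The value at `t ∈ [0, ∞]` of a nondecreasing function `α` on `[0, ∞)`:
`α t` for finite `t`, and `lim_{r → ∞} α r = sup_r α r` at `t = ∞`. -/
noncomputable def extendTop (α : ℝ≥0 → ℝ≥0∞) (t : ℝ≥0∞) : ℝ≥0∞ :=
  if t = ⊤ then ⨆ r, α r else α t.toNNReal

/-- A (symmetric) Dirichlet form on `L²(μ)`: a densely defined, symmetric, nonnegative, closed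
bilinear form which is Markovian, i.e. stable under the unit contraction `f ↦ (f ∨ 0) ∧ 1`. -/
structure DirichletForm {X : Type*} [MeasurableSpace X] (μ : Measure X) where
  domain : Submodule ℝ (Lp ℝ 2 μ)
  form : domain →ₗ[ℝ] domain →ₗ[ℝ] ℝ
  dense : Dense (domain : Set (Lp ℝ 2 μ))
  symm : ∀ f g, form f g = form g f
  nonneg : ∀ f, 0 ≤ form f f
  /-- The domain is complete for the norm `(𝓔(f, f) + ‖f‖²)^{1/2}`. -/
  closed : ∀ u : ℕ → domain,
    (∀ ε : ℝ, 0 < ε → ∃ N, ∀ m ≥ N, ∀ k ≥ N,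
      form (u m - u k) (u m - u k) + ‖((u m - u k : domain) : Lp ℝ 2 μ)‖ ^ 2 < ε) →
    ∃ v : domain, Tendsto
      (fun m => form (u m - v) (u m - v) + ‖((u m - v : domain) : Lp ℝ 2 μ)‖ ^ 2) atTop (𝓝 0)
  markov : ∀ (f : domain) (g : Lp ℝ 2 μ),
    (∀ᵐ x ∂μ, g x = min (max ((f : Lp ℝ 2 μ) x) 0) 1) →
    ∃ hg : g ∈ domain, form ⟨g, hg⟩ ⟨g, hg⟩ ≤ form f f

/-- A nonnegative functional `g ↦ 𝓔(g, g)` on a domain in `L²(μ)`; only the values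
of `energy` on `domain` matter. -/
structure L2Energy {X : Type*} [MeasurableSpace X] (μ : Measure X) where
  domain : Set (Lp ℝ 2 μ)
  energy : Lp ℝ 2 μ → ℝ≥0∞

namespace L2Energy

variable {X : Type*} [MeasurableSpace X] {μ : Measure X}

/-- A function `g` is square integrable with class in the domain. -/
def Mem (F : L2Energy μ) (g : X → ℝ) : Prop :=
  ∃ h : MemLp g 2 μ, h.toLp g ∈ F.domain

open Classical in
/-- `𝓔(g, g)` for a function `g` (used only where `F.Mem g`). -/
noncomputable def eval (F : L2Energy μ) (g : X → ℝ) : ℝ≥0∞ :=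
  if h : MemLp g 2 μ then F.energy (h.toLp g) else ⊤

end L2Energy

open Classical in
/-- The diagonal `g ↦ 𝓔(g, g)` of a Dirichlet form, with its domain. -/
noncomputable def DirichletForm.toL2Energy {X : Type*} [MeasurableSpace X] {μ : Measure X}
    (E : DirichletForm μ) : L2Energy μ where
  domain := E.domain
  energy g := if h : g ∈ E.domain then ENNReal.ofReal (E.form ⟨g, h⟩ ⟨g, h⟩) else ⊤

/-- The section `gᵢ` of `g` through `x`: all coordinates but the `i`-th are frozen. -/
def coordSection {n : ℕ} {X : Fin n → Type*} (g : (∀ i, X i) → ℝ) (i : Fin n) (x : ∀ i, X i) :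
    X i → ℝ :=
  fun t => g (Function.update x i t)

/-- The sum form `⊕ᵢ 𝓔ᵢ` on `L²(μ₁ ⊗ ⋯ ⊗ μₙ)`: its domain consists of the `g` with
`gᵢ ∈ 𝔻(𝓔ᵢ)` almost everywhere for each `i` and `∫ ∑ᵢ 𝓔ᵢ(gᵢ, gᵢ) dμ < ∞`,
and that integral is its value at `(g, g)`. -/
noncomputable def sumForm {n : ℕ} {X : Fin n → Type*} [∀ i, MeasurableSpace (X i)]
    {μ : ∀ i, Measure (X i)} (F : ∀ i, L2Energy (μ i)) : L2Energy (Measure.pi μ) where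
  domain := {g | (∀ i, ∀ᵐ x ∂(Measure.pi μ), (F i).Mem (coordSection g i x)) ∧
    ∫⁻ x, ∑ i, (F i).eval (coordSection g i x) ∂(Measure.pi μ) < ⊤}
  energy g := ∫⁻ x, ∑ i, (F i).eval (coordSection g i x) ∂(Measure.pi μ)

/-- The function `√f` with `f = dν/dμ`. -/
noncomputable def sqrtDensity {X : Type*} [MeasurableSpace X] (ν μ : Measure X) : X → ℝ :=
  fun x => √(ν.rnDeriv μ x).toReal

open Classical in
/-- The Fisher-Donsker-Varadhan information `I(ν | μ)`: it is `𝓔(√f, √f)` if `ν = f μ` and `√f`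
is in the domain of `𝓔`, and `+∞` otherwise. -/
noncomputable def fisherInfo {X : Type*} [MeasurableSpace X] {μ : Measure X} (F : L2Energy μ)
    (ν : Measure X) : ℝ≥0∞ :=
  if ν ≪ μ ∧ F.Mem (sqrtDensity ν μ) then F.eval (sqrtDensity ν μ) else ⊤

open ProbabilityTheory

/-! Write `ν = G² μ` with `G ≥ 0`, and let `Bᵢ` be the integral of the energies `𝓔ᵢ(Gᵢ, Gᵢ)` of the
sections. Given the other coordinates, the conditional law of `xᵢ` has density `Gᵢ² / a`, where `a =
∫ Gᵢ² dμᵢ`. Its information is `𝓔ᵢ(Gᵢ, Gᵢ) / a`, so averaging the one-dimensional inequalities over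
the remaining coordinates, whose law under `ν` has density `a`, cancels the factor `a`. Jensen's
inequality for `αᵢ` then bounds the mean conditional cost by `Rᵢ`, the largest `r` with `αᵢ(r) ≤
Bᵢ`.

It remains to realise all these conditional couplings by a single coupling.
`exists_coordinate_coupling` produces, for each `i`, a law of `(x, yᵢ)` with `x ∼ ν`, with `yᵢ ∼ μᵢ`
independent of the other coordinates of `x`, and with cost at most `Rᵢ + ε`. Disintegrate it given
`(xⱼ)` for `j ≤ i`, and draw the `yᵢ` conditionally independently given `x`. Since `yᵢ` is
independent of the `xⱼ` with `j < i`, peeling off the last coordinate repeatedly shows that `y ∼ μ`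
(`lintegral_prod_adapted_kernels`). Hence `T ≤ ∑ Rᵢ`, and the infimal convolution at `T` is at most
`∑ αᵢ(Rᵢ) ≤ ∑ Bᵢ`.

The measurable choice of near-optimal couplings is made for truncated costs; tightness of couplings
with fixed marginals and lower semicontinuity remove the truncation. -/

/-! ### Measurable choice of near-optimal couplings -/

theorem exists_dense_seq_density {X : Type*} [MeasurableSpace X]
    [MeasurableSpace.CountablyGenerated X] (m : Measure X) [IsProbabilityMeasure m] :
    ∃ v : ℕ → X → ℝ≥0∞, (∀ j, Measurable (v j)) ∧ (∀ j, ∫⁻ x, v j x ∂m = 1) ∧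
      ∀ u : X → ℝ≥0∞, Measurable u → ∫⁻ x, u x ∂m = 1 → ∀ ε : ℝ≥0∞, ε ≠ 0 →
        ∃ j, ∫⁻ x, (u x - v j x) ∂m < ε := by
  have h1 : Fact ((1 : ℝ≥0∞) ≠ ⊤) := ⟨by simp⟩
  let S : Set (Lp ℝ 1 m) := {f | (∀ᵐ x ∂m, 0 ≤ f x) ∧ ∫⁻ x, ENNReal.ofReal (f x) ∂m = 1}
  have hmem : ∀ u : X → ℝ≥0∞, Measurable u → ∫⁻ x, u x ∂m = 1 →
      ∃ f ∈ S, ∀ᵐ x ∂m, f x = (u x).toReal := by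
    intro u hu hu1
    have hfin : ∀ᵐ x ∂m, u x < ⊤ := ae_lt_top hu (by simp [hu1])
    have hint : Integrable (fun x => (u x).toReal) m :=
      integrable_toReal_of_lintegral_ne_top hu.aemeasurable (by simp [hu1])
    have hL : MemLp (fun x => (u x).toReal) 1 m := memLp_one_iff_integrable.2 hint
    refine ⟨hL.toLp _, ⟨?_, ?_⟩, hL.coeFn_toLp⟩
    · filter_upwards [hL.coeFn_toLp] with x hx
      rw [hx]; exact ENNReal.toReal_nonneg
    · refine (lintegral_congr_ae ?_).trans hu1
      filter_upwards [hL.coeFn_toLp, hfin] with x hx hx'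
      rw [hx, ENNReal.ofReal_toReal hx'.ne]
  have hne : Nonempty S := by
    obtain ⟨f, hf, -⟩ := hmem (fun _ => 1) measurable_const (by simp)
    exact ⟨⟨f, hf⟩⟩
  -- `L¹(m)` is separable because the σ-field is countably generated, hence so is its subset `S`.
  let d := TopologicalSpace.denseSeq S
  refine ⟨fun j x => ENNReal.ofReal ((d j : Lp ℝ 1 m) x), fun j => ?_, fun j => (d j).2.2, ?_⟩
  · exact (Lp.stronglyMeasurable _).measurable.ennreal_ofReal
  · intro u hu hu1 ε hε
    obtain ⟨f, hf, hfu⟩ := hmem u hu hu1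
    have hfin : ∀ᵐ x ∂m, u x < ⊤ := ae_lt_top hu (by simp [hu1])
    obtain ⟨y, ⟨j, rfl⟩, hj⟩ := EMetric.mem_closure_iff.1
      (TopologicalSpace.denseRange_denseSeq S ⟨f, hf⟩) ε (pos_iff_ne_zero.2 hε)
    refine ⟨j, lt_of_le_of_lt ?_ hj⟩
    rw [Subtype.edist_eq, Lp.edist_def, eLpNorm_one_eq_lintegral_enorm]
    refine lintegral_mono_ae ?_
    filter_upwards [hfu, hfin, (d j).2.1] with x hx hx' hd
    simp only [Pi.sub_apply]
    rw [hx, Real.enorm_eq_ofReal_abs]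
    nth_rw 1 [← ENNReal.ofReal_toReal hx'.ne]
    rw [← ENNReal.ofReal_sub _ hd]
    exact ENNReal.ofReal_le_ofReal (le_abs_self _)

/-- Stability of couplings in total variation, measurably in `y`. Keep the fraction `min(u, v) / v`
of `π`. For the mass removed, of size `δ = ∫ (u - v)⁺`, retain its second marginal and redraw the
first coordinate independently from `(u - v)⁺ / δ`. Only this mass can cost up to `C`. -/
theorem exists_kernel_coupling_of_coupling {X Y : Type*} [MeasurableSpace X] [MeasurableSpace Y]
    (m : Measure X) [IsProbabilityMeasure m] (c : X × X → ℝ≥0∞) (hc : Measurable c)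
    (C : ℝ≥0∞) (hcC : ∀ p, c p ≤ C)
    (u : Y → X → ℝ≥0∞) (hu : Measurable (Function.uncurry u)) (hu1 : ∀ y, ∫⁻ x, u y x ∂m = 1)
    (v : X → ℝ≥0∞) (hv : Measurable v) (hv1 : ∫⁻ x, v x ∂m = 1)
    (π : Measure (X × X)) (hπ₁ : π.map Prod.fst = m.withDensity v) (hπ₂ : π.map Prod.snd = m) :
    ∃ K : Kernel Y (X × X), ∀ y, (K y).map Prod.fst = m.withDensity (u y) ∧
      (K y).map Prod.snd = m ∧
      ∫⁻ p, c p ∂(K y) ≤ ∫⁻ p, c p ∂π + C * ∫⁻ x, (u y x - v x) ∂m := by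
  have : IsProbabilityMeasure π := by
    constructor
    rw [← Set.preimage_univ (f := Prod.snd), ← Measure.map_apply measurable_snd .univ, hπ₂]
    simp
  have huy : ∀ y, Measurable (u y) := fun y => Measurable.of_uncurry_left hu
  have hu2 : Measurable fun q : Y × X => u q.1 q.2 := hu
  have hπfst : ∀ g : X → ℝ≥0∞, Measurable g → ∫⁻ p, g p.1 ∂π = ∫⁻ x, v x * g x ∂m := by
    intro g hg
    rw [← lintegral_map hg measurable_fst, hπ₁, lintegral_withDensity_eq_lintegral_mul _ hv hg]
    rfl
  have hπsnd : ∀ g : X → ℝ≥0∞, Measurable g → ∫⁻ p, g p.2 ∂π = ∫⁻ x, g x ∂m := by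
    intro g hg
    rw [← lintegral_map hg measurable_snd, hπ₂]
  have hvfin : ∀ᵐ x ∂m, v x < ⊤ := ae_lt_top hv (by simp [hv1])
  have hs : ∀ y, Measurable fun x => u y x - v x := fun y => (huy y).sub hv
  -- Where `v x = 0` the convention `0 / 0 = 0` applies, so `θ ≤ 1` everywhere.
  let θ : Y → X → ℝ≥0∞ := fun y x => min (u y x) (v x) / v x
  have hθ : Measurable fun q : Y × X => θ q.1 q.2 :=
    (hu2.min (hv.comp measurable_snd)).div (hv.comp measurable_snd)
  have hθy : ∀ y, Measurable (θ y) := fun y => Measurable.of_uncurry_left (f := θ) hθ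
  have hθs : ∀ y, Measurable fun p : X × X => 1 - θ y p.1 := fun y =>
    measurable_const.sub ((hθy y).comp measurable_fst)
  have hθ1 : ∀ y x, θ y x ≤ 1 := fun y x => ENNReal.div_le_of_le_mul (by simp)
  have hθv : ∀ y, ∀ᵐ x ∂m, v x * θ y x = min (u y x) (v x) := by
    intro y
    filter_upwards [hvfin] with x hx
    rcases eq_or_ne (v x) 0 with h0 | h0
    · simp [h0]
    · exact ENNReal.mul_div_cancel h0 hx.ne
  let δ : Y → ℝ≥0∞ := fun y => ∫⁻ x, (u y x - v x) ∂m
  have hδ : Measurable δ := (hu2.sub (hv.comp measurable_snd)).lintegral_prod_right'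
  have hmin : ∀ y, ∫⁻ x, min (u y x) (v x) ∂m ≠ ⊤ := fun y =>
    ((lintegral_mono fun x => min_le_left _ _).trans_lt (by simp [hu1 y])).ne
  have hδu : ∀ y, δ y + ∫⁻ x, min (u y x) (v x) ∂m = 1 := by
    intro y
    change ∫⁻ x, (u y x - v x) ∂m + _ = _
    rw [← lintegral_add_left (hs y), ← hu1 y]
    exact lintegral_congr fun x => tsub_add_min
  have hδtop : ∀ y, δ y ≠ ⊤ := fun y h => by
    have := hδu y; rw [h] at this; simp at this
  have hδv : ∀ y, ∫⁻ p, (1 - θ y p.1) ∂π = δ y := by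
    intro y
    rw [hπfst (fun x => 1 - θ y x) (measurable_const.sub (hθy y))]
    have h1 : ∫⁻ x, v x * (1 - θ y x) ∂m + ∫⁻ x, min (u y x) (v x) ∂m = 1 := by
      rw [← lintegral_add_right _ ((huy y).min hv)]
      refine (lintegral_congr_ae ?_).trans hv1
      filter_upwards [hθv y] with x hx
      rw [← hx, ← mul_add, tsub_add_cancel_of_le (hθ1 y x), mul_one]
    exact (ENNReal.add_left_inj (hmin y)).1 (h1.trans (hδu y).symm)
  let w : Y → X × (X × X) → ℝ≥0∞ := fun y q => (δ y)⁻¹ * ((u y q.1 - v q.1) * (1 - θ y q.2.1))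
  have hw : Measurable (Function.uncurry w) := by
    have h1 : Measurable fun z : Y × (X × (X × X)) => u z.1 z.2.1 :=
      hu2.comp (f := fun z : Y × (X × (X × X)) => (z.1, z.2.1)) (by fun_prop)
    have h2 : Measurable fun z : Y × (X × (X × X)) => θ z.1 z.2.2.1 :=
      hθ.comp (f := fun z : Y × (X × (X × X)) => (z.1, z.2.2.1)) (by fun_prop)
    exact (hδ.comp measurable_fst).inv.mul
      ((h1.sub (hv.comp (by fun_prop))).mul (measurable_const.sub h2))
  have hθ' : Measurable (Function.uncurry fun (y : Y) (p : X × X) => θ y p.1) :=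
    hθ.comp (f := fun z : Y × (X × X) => (z.1, z.2.1)) (by fun_prop)
  let ι : X × (X × X) → X × X := fun q => (q.1, q.2.2)
  have hι : Measurable ι := by fun_prop
  let K₁ : Kernel Y (X × X) := Kernel.withDensity (Kernel.const Y π) fun y p => θ y p.1
  let K₂ : Kernel Y (X × X) := (Kernel.withDensity (Kernel.const Y (m.prod π)) w).map ι
  have hK₁ : ∀ y (g : X × X → ℝ≥0∞), Measurable g →
      ∫⁻ p, g p ∂(K₁ y) = ∫⁻ p, θ y p.1 * g p ∂π := by
    intro y g hg
    rw [Kernel.lintegral_withDensity _ hθ' y hg, Kernel.const_apply]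
  have hK₂ : ∀ y (g h : X → ℝ≥0∞), Measurable g → Measurable h →
      ∫⁻ p, g p.1 * h p.2 ∂(K₂ y) =
        (δ y)⁻¹ * ((∫⁻ x, (u y x - v x) * g x ∂m) * ∫⁻ p, (1 - θ y p.1) * h p.2 ∂π) := by
    intro y g h hg hh
    have hg' : Measurable fun p : X × X => g p.1 * h p.2 := by fun_prop
    rw [Kernel.map_apply _ hι, lintegral_map hg' hι,
      Kernel.lintegral_withDensity _ hw y (g := fun q => g (ι q).1 * h (ι q).2) (hg'.comp hι),
      Kernel.const_apply, ← lintegral_prod_mul, ← lintegral_const_mul]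
    · refine lintegral_congr fun q => ?_
      simp only [w, ι]
      ring
    · exact (((huy y).comp measurable_fst).sub (hv.comp measurable_fst)).mul (by fun_prop) |>.mul
        (((measurable_const.sub ((hθy y).comp (by fun_prop))).mul (by fun_prop)))
    · exact (((huy y).sub hv).mul hg).aemeasurable
    · exact ((measurable_const.sub ((hθy y).comp measurable_fst)).mul (by fun_prop)).aemeasurable
  have hK₂fst : ∀ y (g : X → ℝ≥0∞), Measurable g →
      ∫⁻ p, g p.1 ∂(K₂ y) = ∫⁻ x, (u y x - v x) * g x ∂m := by
    intro y g hg
    have := hK₂ y g (fun _ => 1) hg measurable_const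
    simp only [mul_one] at this
    rw [this, hδv]
    -- If `δ y = 0` then `(δ y)⁻¹ = ∞`, but it multiplies `0`, and no mass is redrawn.
    rcases eq_or_ne (δ y) 0 with h0 | h0
    · have h0' := (lintegral_eq_zero_iff (hs y)).1 h0
      rw [lintegral_congr_ae (g := 0)]
      · simp
      · filter_upwards [h0'] with x hx
        simp only [Pi.zero_apply] at hx ⊢
        rw [show u y x - v x = 0 from hx, zero_mul]
    · rw [mul_comm, mul_assoc, ENNReal.mul_inv_cancel h0 (hδtop y), mul_one]
  have hK₂snd : ∀ y (g : X → ℝ≥0∞), Measurable g →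
      ∫⁻ p, g p.2 ∂(K₂ y) = ∫⁻ p, (1 - θ y p.1) * g p.2 ∂π := by
    intro y g hg
    have := hK₂ y (fun _ => 1) g measurable_const hg
    simp only [mul_one, one_mul] at this
    rw [this]
    rcases eq_or_ne (δ y) 0 with h0 | h0
    · have h0' := (lintegral_eq_zero_iff (hθs y)).1 ((hδv y).trans h0)
      rw [show ∫⁻ x, (u y x - v x) ∂m = 0 from h0, zero_mul, mul_zero,
        lintegral_congr_ae (g := 0)]
      · simp
      · filter_upwards [h0'] with x hx
        simp only [Pi.zero_apply] at hx ⊢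
        rw [hx, zero_mul]
    · rw [← mul_assoc, show ∫⁻ x, (u y x - v x) ∂m = δ y from rfl,
        ENNReal.inv_mul_cancel h0 (hδtop y), one_mul]
  have hKadd : ∀ y (g : X × X → ℝ≥0∞),
      ∫⁻ p, g p ∂((K₁ + K₂) y) = ∫⁻ p, g p ∂(K₁ y) + ∫⁻ p, g p ∂(K₂ y) := by
    intro y g
    rw [_root_.add_apply, lintegral_add_measure]
  refine ⟨K₁ + K₂, fun y => ⟨?_, ?_, ?_⟩⟩
  · refine Measure.ext_of_lintegral _ fun g hg => ?_
    rw [lintegral_map hg measurable_fst, hKadd, hK₁ y _ (by fun_prop), hK₂fst y g hg,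
      hπfst (fun x => θ y x * g x) ((hθy y).mul hg),
      lintegral_withDensity_eq_lintegral_mul _ (huy y) hg,
      ← lintegral_add_right (g := fun x => (u y x - v x) * g x) _ ((hs y).mul hg)]
    refine lintegral_congr_ae ?_
    filter_upwards [hθv y] with x hx
    rw [← mul_assoc, hx, ← add_mul, Pi.mul_apply]
    rw [add_comm (min _ _), tsub_add_min]
  · refine Measure.ext_of_lintegral _ fun g hg => ?_
    rw [lintegral_map hg measurable_snd, hKadd, hK₁ y _ (by fun_prop), hK₂snd y g hg,
      ← hπsnd g hg, ← lintegral_add_left (f := fun p : X × X => θ y p.1 * g p.2)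
        (((hθy y).comp measurable_fst).mul (hg.comp measurable_snd))]
    refine lintegral_congr fun p => ?_
    rw [← add_mul, add_tsub_cancel_of_le (hθ1 y p.1), one_mul]
  · rw [hKadd, hK₁ y c hc]
    refine add_le_add (lintegral_mono fun p => mul_le_of_le_one_left' (hθ1 y p.1)) ?_
    refine (lintegral_mono hcC).trans ?_
    rw [lintegral_const]
    have := hK₂fst y (fun _ => 1) measurable_const
    simp only [lintegral_one, mul_one] at this
    rw [this]

theorem transportCost_le_of_le {X : Type*} [MeasurableSpace X] (c : X → X → ℝ≥0∞)
    {ν μ : Measure X} (π : Measure (X × X)) (h₁ : π.map Prod.fst = ν) (h₂ : π.map Prod.snd = μ) :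
    transportCost c ν μ ≤ ∫⁻ p, c p.1 p.2 ∂π :=
  iInf_le_of_le π (iInf_le_of_le h₁ (iInf_le_of_le h₂ le_rfl))

theorem transportCost_le_const {X : Type*} [MeasurableSpace X] (c : X → X → ℝ≥0∞)
    (ν μ : Measure X) [IsProbabilityMeasure ν] [IsProbabilityMeasure μ] (C : ℝ≥0∞)
    (hcC : ∀ x y, c x y ≤ C) : transportCost c ν μ ≤ C := by
  refine (transportCost_le_of_le c (ν.prod μ) (by simp) (by simp)).trans ?_
  refine (lintegral_mono (g := fun _ => C) fun p : X × X => hcC p.1 p.2).trans ?_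
  simp

theorem exists_coupling_lintegral_lt {X : Type*} [MeasurableSpace X] {c : X → X → ℝ≥0∞}
    {ν μ : Measure X} {r : ℝ≥0∞} (h : transportCost c ν μ < r) :
    ∃ π : Measure (X × X), π.map Prod.fst = ν ∧ π.map Prod.snd = μ ∧
      ∫⁻ p, c p.1 p.2 ∂π < r := by
  simp only [transportCost, iInf_lt_iff] at h
  obtain ⟨π, h₁, h₂, h₃⟩ := h
  exact ⟨π, h₁, h₂, h₃⟩

theorem exists_coupling_lintegral_le_add {X : Type*} [MeasurableSpace X] {c : X → X → ℝ≥0∞}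
    {ν μ : Measure X} (h : transportCost c ν μ ≠ ⊤) {ε : ℝ≥0∞} (hε : ε ≠ 0) :
    ∃ π : Measure (X × X), π.map Prod.fst = ν ∧ π.map Prod.snd = μ ∧
      ∫⁻ p, c p.1 p.2 ∂π ≤ transportCost c ν μ + ε := by
  obtain ⟨π, h₁, h₂, h₃⟩ := exists_coupling_lintegral_lt (ENNReal.lt_add_right h hε)
  exact ⟨π, h₁, h₂, h₃.le⟩

theorem isProbabilityMeasure_withDensity_of_lintegral {X : Type*} [MeasurableSpace X]
    {m : Measure X} {u : X → ℝ≥0∞} (hu : ∫⁻ x, u x ∂m = 1) :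
    IsProbabilityMeasure (m.withDensity u) :=
  ⟨by rw [withDensity_apply _ .univ, Measure.restrict_univ, hu]⟩

/-- Replaces a measurable selection theorem: fix near-optimal couplings for countably many densities
dense in `L¹`, and for each `y` correct the one attached to the first density close enough to `u y`.
-/
theorem exists_kernel_coupling_le_transportCost {X Y : Type*} [MeasurableSpace X]
    [MeasurableSpace.CountablyGenerated X] [MeasurableSpace Y]
    (m : Measure X) [IsProbabilityMeasure m] (c : X → X → ℝ≥0∞)
    (hc : Measurable fun p : X × X => c p.1 p.2)
    (C : ℝ≥0) (hcC : ∀ x y, c x y ≤ C)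
    (u : Y → X → ℝ≥0∞) (hu : Measurable (Function.uncurry u)) (hu1 : ∀ y, ∫⁻ x, u y x ∂m = 1)
    {ε : ℝ≥0∞} (hε : ε ≠ 0) :
    ∃ K : Kernel Y (X × X), ∀ y, (K y).map Prod.fst = m.withDensity (u y) ∧
      (K y).map Prod.snd = m ∧
      ∫⁻ p, c p.1 p.2 ∂(K y) ≤ transportCost c (m.withDensity (u y)) m + ε := by
  classical
  obtain ⟨v, hv, hv1, hvd⟩ := exists_dense_seq_density m
  have huy : ∀ y, Measurable (u y) := fun y => Measurable.of_uncurry_left hu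
  have hu2 : Measurable fun q : Y × X => u q.1 q.2 := hu
  have hprob : ∀ w : X → ℝ≥0∞, ∫⁻ x, w x ∂m = 1 → transportCost c (m.withDensity w) m ≠ ⊤ := by
    intro w hw
    have := isProbabilityMeasure_withDensity_of_lintegral hw
    exact ((transportCost_le_const c _ m C hcC).trans_lt ENNReal.coe_lt_top).ne
  -- Four errors: the near-optimal couplings for `v j` and for `u y`, and the passage between the
  -- two densities in each direction.
  have hε4 : ε / 4 ≠ 0 := by simp [hε]
  choose π hπ₁ hπ₂ hπc using fun j => exists_coupling_lintegral_le_add (hprob (v j) (hv1 j)) hε4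
  choose K hK using fun j => exists_kernel_coupling_of_coupling m (fun p : X × X => c p.1 p.2) hc C
    (fun p => hcC p.1 p.2) u hu hu1 (v j) (hv j) (hv1 j) (π j) (hπ₁ j) (hπ₂ j)
  let η : ℝ≥0∞ := ε / 4 / (C + 1)
  have hη : η ≠ 0 := by simp [η, hε, ENNReal.div_eq_zero_iff]
  have hCη : C * η ≤ ε / 4 := by
    calc C * η ≤ (C + 1) * η := by gcongr; exact le_self_add
      _ = ε / 4 := ENNReal.mul_div_cancel (by simp) (by simp)
  have hex : ∀ y, ∃ j, ∫⁻ x, (u y x - v j x) ∂m < η := fun y => hvd (u y) (huy y) (hu1 y) η hη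
  let J : Y → ℕ := fun y => Nat.find (hex y)
  have hJ : ∀ y, ∫⁻ x, (u y x - v (J y) x) ∂m < η := fun y => Nat.find_spec (hex y)
  have hmeas : Measurable fun y => K (J y) y := by
    refine Measurable.find (f := fun j y => K j y) (fun j => (K j).measurable) (fun j => ?_) hex
    exact measurableSet_lt ((hu2.sub ((hv j).comp measurable_snd)).lintegral_prod_right')
      measurable_const
  refine ⟨⟨fun y => K (J y) y, hmeas⟩, fun y => ⟨(hK (J y) y).1, (hK (J y) y).2.1, ?_⟩⟩
  set j := J y
  -- the cost of `v j` is controlled by transporting a near optimal coupling of `u y`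
  have hrev : transportCost c (m.withDensity (v j)) m ≤
      transportCost c (m.withDensity (u y)) m + ε / 4 + ε / 4 := by
    obtain ⟨ρ, hρ₁, hρ₂, hρc⟩ := exists_coupling_lintegral_le_add (hprob (u y) (hu1 y)) hε4
    obtain ⟨K', hK'⟩ := exists_kernel_coupling_of_coupling m (fun p : X × X => c p.1 p.2) hc C
      (fun p => hcC p.1 p.2) (fun _ : Unit => v j) ((hv j).comp measurable_snd) (fun _ => hv1 j)
      (u y) (huy y) (hu1 y) ρ hρ₁ hρ₂
    obtain ⟨h₁, h₂, h₃⟩ := hK' ()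
    refine (transportCost_le_of_le c _ h₁ h₂).trans (h₃.trans (add_le_add hρc ?_))
    have hsymm : ∫⁻ x, (v j x - u y x) ∂m = ∫⁻ x, (u y x - v j x) ∂m := by
      have hmin : ∫⁻ x, min (u y x) (v j x) ∂m ≠ ⊤ :=
        ((lintegral_mono fun x => min_le_left _ _).trans_lt (by simp [hu1 y])).ne
      refine (ENNReal.add_left_inj hmin).1 ?_
      rw [← lintegral_add_left (f := fun x => v j x - u y x) ((hv j).sub (huy y)),
        ← lintegral_add_left (f := fun x => u y x - v j x) ((huy y).sub (hv j))]
      trans (1 : ℝ≥0∞)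
      · rw [← hv1 j]
        exact lintegral_congr fun x => by rw [min_comm, tsub_add_min]
      · rw [← hu1 y]
        exact lintegral_congr fun x => tsub_add_min.symm
    rw [hsymm]
    exact (mul_le_mul_right (hJ y).le _).trans hCη
  calc ∫⁻ p, c p.1 p.2 ∂(K j y)
      ≤ ∫⁻ p, c p.1 p.2 ∂(π j) + C * ∫⁻ x, (u y x - v j x) ∂m := (hK j y).2.2
    _ ≤ (transportCost c (m.withDensity (u y)) m + ε / 4 + ε / 4 + ε / 4) + ε / 4 :=
        add_le_add ((hπc j).trans (by gcongr)) ((mul_le_mul_right (hJ y).le _).trans hCη)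
    _ = transportCost c (m.withDensity (u y)) m + (ε / 4 + ε / 4 + (ε / 4 + ε / 4)) := by ring
    _ = transportCost c (m.withDensity (u y)) m + ε := by
        congr 1
        rw [show (4 : ℝ≥0∞) = 2 * 2 by norm_num, ENNReal.div_eq_inv_mul,
          ENNReal.mul_inv (by simp) (by simp), mul_assoc, ← ENNReal.div_eq_inv_mul,
          ← ENNReal.div_eq_inv_mul, ENNReal.add_halves, ENNReal.add_halves]

/-! ### Gluing coordinate couplings through adapted kernels -/

theorem measurable_measure_pi {n : ℕ} {X : Fin n → Type*} [∀ i, MeasurableSpace (X i)]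
    {Y : Type*} [MeasurableSpace Y] (k : ∀ i, Kernel Y (X i)) [∀ i, IsMarkovKernel (k i)] :
    Measurable fun y => Measure.pi fun i => k i y := by
  refine Measurable.measure_of_isPiSystem_of_isProbabilityMeasure generateFrom_pi.symm
    isPiSystem_pi ?_
  rintro _ ⟨s, hs, rfl⟩
  simp only [Measure.pi_pi]
  exact Finset.measurable_fun_prod _ fun i _ => (k i).measurable_coe (hs i (Set.mem_univ i))

/-- The factors of index below `l` depend only on coordinates below `l`, so `hind` pulls the factor
of index `l` out as `μ l (s l)`; induct on `l`. -/
theorem lintegral_prod_adapted_kernels {n : ℕ} {X : Fin n → Type*} [∀ i, MeasurableSpace (X i)]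
    (μ : ∀ i, Measure (X i)) (ν : Measure (∀ i, X i)) [IsProbabilityMeasure ν]
    (k : ∀ i, Kernel (∀ j, X j) (X i)) (hdep : ∀ i, DependsOn (k i) (Set.Iic i))
    (hind : ∀ i (h : (∀ j, X j) → ℝ≥0∞), Measurable h → DependsOn h (Set.Iio i) →
      ∀ B, MeasurableSet B → ∫⁻ x, h x * k i x B ∂ν = μ i B * ∫⁻ x, h x ∂ν)
    (s : ∀ i, Set (X i)) (hs : ∀ i, MeasurableSet (s i)) :
    ∫⁻ x, ∏ i, k i x (s i) ∂ν = ∏ i, μ i (s i) := by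
  have key : ∀ l : ℕ, ∫⁻ x, ∏ i with i.val < l, k i x (s i) ∂ν =
      ∏ i with i.val < l, μ i (s i) := by
    intro l
    induction l with
    | zero => simp
    | succ l ih =>
      by_cases hl : l < n
      · have hins : (Finset.univ.filter fun i : Fin n => i.val < l + 1) =
            insert ⟨l, hl⟩ (Finset.univ.filter fun i : Fin n => i.val < l) := by
          ext i
          simp only [Finset.mem_filter, Finset.mem_univ, true_and, Finset.mem_insert, Fin.ext_iff]
          omega
        have hnot : (⟨l, hl⟩ : Fin n) ∉ Finset.univ.filter fun i : Fin n => i.val < l := by simp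
        simp only [hins, Finset.prod_insert hnot]
        rw [← ih, ← hind ⟨l, hl⟩ _ _ _ _ (hs _)]
        · simp only [mul_comm]
        · exact Finset.measurable_fun_prod _ fun i _ => (k i).measurable_coe (hs i)
        · intro x y hxy
          refine Finset.prod_congr rfl fun i hi => ?_
          have hi' : i.val < l := by simpa using hi
          rw [hdep i fun j hj => hxy j (lt_of_le_of_lt (Set.mem_Iic.1 hj) (Fin.lt_def.2 hi'))]
      · have : (Finset.univ.filter fun i : Fin n => i.val < l + 1) =
            Finset.univ.filter fun i : Fin n => i.val < l := by
          ext i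
          have := i.2
          simp only [Finset.mem_filter, Finset.mem_univ, true_and]
          omega
        simp only [this, ih]
  have := key n
  simpa using this

/-- Given `x`, the `yᵢ` are drawn independently from `k i x`; the previous identity on boxes
identifies the law of `y`. -/
theorem exists_coupling_of_adapted_kernels {n : ℕ} {X : Fin n → Type*}
    [∀ i, MeasurableSpace (X i)] (μ : ∀ i, Measure (X i)) [∀ i, IsProbabilityMeasure (μ i)]
    (ν : Measure (∀ i, X i)) [IsProbabilityMeasure ν]
    (k : ∀ i, Kernel (∀ j, X j) (X i)) [∀ i, IsMarkovKernel (k i)]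
    (hdep : ∀ i, DependsOn (k i) (Set.Iic i))
    (hind : ∀ i (h : (∀ j, X j) → ℝ≥0∞), Measurable h → DependsOn h (Set.Iio i) →
      ∀ B, MeasurableSet B → ∫⁻ x, h x * k i x B ∂ν = μ i B * ∫⁻ x, h x ∂ν) :
    ∃ π : Measure ((∀ i, X i) × (∀ i, X i)), π.map Prod.fst = ν ∧ π.map Prod.snd = Measure.pi μ ∧
      ∀ i (f : X i × X i → ℝ≥0∞), Measurable f →
        ∫⁻ p, f (p.1 i, p.2 i) ∂π = ∫⁻ x, ∫⁻ y, f (x i, y) ∂(k i x) ∂ν := by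
  let K : Kernel (∀ j, X j) (∀ j, X j) := ⟨fun x => Measure.pi fun i => k i x,
    measurable_measure_pi k⟩
  have hK : ∀ x, K x = Measure.pi fun i => k i x := fun x => rfl
  have : IsMarkovKernel K := ⟨fun x => by rw [hK]; infer_instance⟩
  refine ⟨ν ⊗ₘ K, Measure.fst_compProd ν K, ?_, ?_⟩
  · refine (Measure.pi_eq fun s hs => ?_).symm
    rw [Measure.map_apply measurable_snd (MeasurableSet.univ_pi hs),
      Measure.compProd_apply (measurable_snd (MeasurableSet.univ_pi hs)),
      ← lintegral_prod_adapted_kernels μ ν k hdep hind s hs]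
    refine lintegral_congr fun x => ?_
    rw [hK, ← Measure.pi_pi]
    rfl
  · intro i f hf
    have hf' : Measurable fun p : (∀ j, X j) × (∀ j, X j) => f (p.1 i, p.2 i) := by fun_prop
    rw [Measure.lintegral_compProd hf']
    refine lintegral_congr fun x => ?_
    have hfx : Measurable fun y => f (x i, y) := by fun_prop
    rw [hK, ← (measurePreserving_eval (fun i => k i x) i).lintegral_comp hfx]

/-- The conditional law of `y` given the coordinates up to `i`. Conditioning on fewer coordinates
than all of `x` makes the kernel adapted, and still suffices for the cost, which sees only `xᵢ` and
`y`. -/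
theorem exists_adapted_kernel {n : ℕ} {X : Fin n → Type*} [∀ i, MeasurableSpace (X i)]
    (ν : Measure (∀ i, X i)) [IsProbabilityMeasure ν] (i : Fin n) [StandardBorelSpace (X i)]
    (P : Measure ((∀ j, X j) × X i)) (hP : P.map Prod.fst = ν) :
    ∃ k : Kernel (∀ j, X j) (X i), IsMarkovKernel k ∧ DependsOn k (Set.Iic i) ∧
      ∀ F : (∀ j, X j) × X i → ℝ≥0∞, Measurable F →
        (∀ y, DependsOn (fun x => F (x, y)) (Set.Iic i)) →
        ∫⁻ x, ∫⁻ y, F (x, y) ∂(k x) ∂ν = ∫⁻ p, F p ∂P := by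
  classical
  have : IsProbabilityMeasure P := by
    constructor
    rw [← Set.preimage_univ (f := Prod.fst), ← Measure.map_apply measurable_fst .univ, hP]
    simp
  obtain ⟨x₀⟩ : Nonempty (∀ j, X j) := nonempty_of_isProbabilityMeasure ν
  have : Nonempty (X i) := ⟨x₀ i⟩
  let R : (∀ j, X j) → (∀ j : Set.Iic i, X j) := fun x j => x j
  have hR : Measurable R := by fun_prop
  -- The fill-in values `x₀` are immaterial: the integrands below ignore the coordinates after `i`.
  let S : (∀ j : Set.Iic i, X j) → (∀ j, X j) := fun z j =>
    if h : j ∈ Set.Iic i then z ⟨j, h⟩ else x₀ j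
  have hS : Measurable S := by
    refine measurable_pi_lambda _ fun j => ?_
    by_cases h : j ∈ Set.Iic i
    · simp only [S, h, dite_true]; fun_prop
    · simp only [S, h, dite_false]; fun_prop
  have hSR : ∀ x, ∀ j ∈ Set.Iic i, S (R x) j = x j := by
    intro x j hj
    simp only [S, R, hj, dite_true]
  let κ := condDistrib Prod.snd (fun p : (∀ j, X j) × X i => R p.1) P
  refine ⟨κ.comap R hR, inferInstance, ?_, ?_⟩
  · intro x y hxy
    rw [Kernel.comap_apply, Kernel.comap_apply]
    congr 1
    funext j
    exact hxy j j.2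
  · intro F hF hdep
    have hRm : Measurable fun p : (∀ j, X j) × X i => R p.1 := hR.comp measurable_fst
    have hF' : Measurable fun q : (∀ j : Set.Iic i, X j) × X i => F (S q.1, q.2) := by fun_prop
    have hmap := compProd_map_condDistrib (μ := P) (mβ := inferInstance)
      (X := fun p : (∀ j, X j) × X i => R p.1) (Y := Prod.snd) measurable_snd.aemeasurable
    calc ∫⁻ x, ∫⁻ y, F (x, y) ∂(κ.comap R hR x) ∂ν
        = ∫⁻ x, ∫⁻ y, F (S (R x), y) ∂(κ (R x)) ∂ν := by
          refine lintegral_congr fun x => lintegral_congr fun y => ?_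
          exact (hdep y (hSR x)).symm
      _ = ∫⁻ z, ∫⁻ y, F (S z, y) ∂(κ z) ∂(ν.map R) := by
          rw [lintegral_map (hF'.lintegral_kernel_prod_right' (κ := κ)) hR]
      _ = ∫⁻ q, F (S q.1, q.2) ∂((P.map fun p => R p.1) ⊗ₘ κ) := by
          rw [Measure.lintegral_compProd hF', ← hP, Measure.map_map hR measurable_fst]
          rfl
      _ = ∫⁻ p, F (S (R p.1), p.2) ∂P := by
          rw [hmap, lintegral_map hF' (hRm.prodMk measurable_snd)]
      _ = ∫⁻ p, F p ∂P := lintegral_congr fun p => hdep p.2 (hSR p.1)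

theorem measurePreserving_update {n : ℕ} {X : Fin n → Type*} [∀ i, MeasurableSpace (X i)]
    (μ : ∀ i, Measure (X i)) [∀ i, IsProbabilityMeasure (μ i)] (i : Fin n) :
    MeasurePreserving (fun q : (∀ j, X j) × X i => Function.update q.1 i q.2)
      ((Measure.pi μ).prod (μ i)) (Measure.pi μ) := by
  have hmeas : Measurable fun q : (∀ j, X j) × X i => Function.update q.1 i q.2 := by
    refine measurable_pi_lambda _ fun j => ?_
    rcases eq_or_ne j i with rfl | h
    · simpa using measurable_snd
    · simp only [Function.update_of_ne h]; fun_prop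
  refine ⟨hmeas, (Measure.pi_eq fun s hs => ?_).symm⟩
  rw [Measure.map_apply hmeas (MeasurableSet.univ_pi hs)]
  have : (fun q : (∀ j, X j) × X i => Function.update q.1 i q.2) ⁻¹' Set.univ.pi s =
      (Set.univ.pi (Function.update s i Set.univ)) ×ˢ (s i) := by
    ext q
    simp only [Set.mem_preimage, Set.mem_univ_pi, Set.mem_prod]
    constructor
    · intro h
      refine ⟨fun j => ?_, by simpa using h i⟩
      rcases eq_or_ne j i with rfl | hj
      · simp
      · simpa [hj] using h j
    · rintro ⟨h, hi⟩ j
      rcases eq_or_ne j i with rfl | hj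
      · simpa using hi
      · simpa [hj] using h j
  rw [this, Measure.prod_prod, Measure.pi_pi, mul_comm,
    ← Finset.mul_prod_erase _ _ (Finset.mem_univ i), ← Finset.mul_prod_erase _ _ (Finset.mem_univ i)]
  simp only [Function.update_self, measure_univ, one_mul]
  congr 1
  refine Finset.prod_congr rfl fun j hj => ?_
  rw [Function.update_of_ne (Finset.ne_of_mem_erase hj)]

/-! ### Weak limits of couplings and removal of the truncation -/

/-- Layer-cake formula and Fatou's lemma over the open superlevel sets, for `f` truncated at `C`;
then monotone convergence in `C`. -/
theorem lintegral_le_liminf_of_lowerSemicontinuous {Ω : Type*} [MeasurableSpace Ω]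
    [TopologicalSpace Ω] [OpensMeasurableSpace Ω] {μ : Measure Ω} {μs : ℕ → Measure Ω}
    {f : Ω → ℝ≥0∞} (hf : LowerSemicontinuous f)
    (h_opens : ∀ G, IsOpen G → μ G ≤ atTop.liminf (fun i ↦ μs i G)) :
    ∫⁻ x, f x ∂μ ≤ atTop.liminf (fun i ↦ ∫⁻ x, f x ∂(μs i)) := by
  have bdd : ∀ C : ℕ, ∫⁻ x, min (f x) C ∂μ ≤ atTop.liminf (fun i ↦ ∫⁻ x, f x ∂(μs i)) := by
    intro C
    let g : Ω → ℝ := fun x => (min (f x) C).toReal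
    have hg : ∀ x, ENNReal.ofReal (g x) = min (f x) C := fun x =>
      ENNReal.ofReal_toReal ((min_le_right _ _).trans_lt (ENNReal.natCast_lt_top C)).ne
    have hg0 : ∀ x, 0 ≤ g x := fun x => ENNReal.toReal_nonneg
    have hgm : Measurable g := (hf.measurable.min measurable_const).ennreal_toReal
    have hopen : ∀ t : ℝ, 0 < t → IsOpen {x | t < g x} := by
      intro t ht
      have : {x | t < g x} = {x | t < C} ∩ f ⁻¹' Set.Ioi (ENNReal.ofReal t) := by
        ext x
        have h : t < g x ↔ ENNReal.ofReal t < min (f x) C := by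
          rw [← hg x, ENNReal.ofReal_lt_ofReal_iff_of_nonneg ht.le]
        have hC : (ENNReal.ofReal t < (C : ℝ≥0∞)) ↔ t < C := by
          rw [← ENNReal.ofReal_natCast, ENNReal.ofReal_lt_ofReal_iff_of_nonneg ht.le]
        simp only [Set.mem_ofPred_eq, Set.mem_inter_iff, Set.mem_preimage, Set.mem_Ioi, h, lt_min_iff, hC]
        tauto
      rw [this]
      exact isOpen_const.inter (hf.isOpen_preimage _)
    calc ∫⁻ x, min (f x) C ∂μ = ∫⁻ x, ENNReal.ofReal (g x) ∂μ := by simp only [hg]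
      _ = ∫⁻ t in Set.Ioi (0 : ℝ), μ {a | t < g a} :=
          lintegral_eq_lintegral_meas_lt _ (.of_forall hg0) hgm.aemeasurable
      _ ≤ ∫⁻ t in Set.Ioi (0 : ℝ), atTop.liminf fun i => μs i {a | t < g a} :=
          setLIntegral_mono' measurableSet_Ioi fun t ht => h_opens _ (hopen t ht)
      _ ≤ atTop.liminf fun i => ∫⁻ t in Set.Ioi (0 : ℝ), μs i {a | t < g a} :=
          lintegral_liminf_le fun n => Antitone.measurable fun s t hst =>
            measure_mono fun ω hω => lt_of_le_of_lt hst hω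
      _ = atTop.liminf fun i => ∫⁻ x, ENNReal.ofReal (g x) ∂(μs i) := by
          congr 1
          funext i
          exact (lintegral_eq_lintegral_meas_lt _ (.of_forall hg0) hgm.aemeasurable).symm
      _ ≤ atTop.liminf fun i => ∫⁻ x, f x ∂(μs i) :=
          liminf_le_liminf (.of_forall fun i => lintegral_mono fun x => by
            rw [hg]; exact min_le_left _ _)
  have hmono : Monotone fun (C : ℕ) x => min (f x) (C : ℝ≥0∞) := fun a b hab x =>
    min_le_min le_rfl (by exact_mod_cast hab)
  have hsup : ∀ x, ⨆ C : ℕ, min (f x) (C : ℝ≥0∞) = f x := by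
    intro x
    have := (inf_iSup_eq (f x) (fun C : ℕ => (C : ℝ≥0∞))).symm
    rw [ENNReal.iSup_natCast, inf_top_eq] at this
    exact this
  calc ∫⁻ x, f x ∂μ = ∫⁻ x, ⨆ C : ℕ, min (f x) (C : ℝ≥0∞) ∂μ := by simp only [hsup]
    _ = ⨆ C : ℕ, ∫⁻ x, min (f x) C ∂μ :=
        lintegral_iSup (fun C => hf.measurable.min measurable_const) hmono
    _ ≤ _ := iSup_le bdd

/-- Tight marginals make the couplings tight, so Prokhorov's theorem applies; the marginals pass to
the limit by continuity of the projections. -/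
theorem exists_subseq_tendsto_of_couplings {W : Type*} [TopologicalSpace W] [PolishSpace W]
    [MeasurableSpace W] [BorelSpace W] {ν μ : Measure W} [IsProbabilityMeasure ν]
    [IsProbabilityMeasure μ] (π : ℕ → ProbabilityMeasure (W × W))
    (h₁ : ∀ k, (π k : Measure (W × W)).map Prod.fst = ν)
    (h₂ : ∀ k, (π k : Measure (W × W)).map Prod.snd = μ) :
    ∃ (π' : ProbabilityMeasure (W × W)) (φ : ℕ → ℕ), StrictMono φ ∧
      Tendsto (π ∘ φ) atTop (𝓝 π') ∧ (π' : Measure (W × W)).map Prod.fst = ν ∧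
      (π' : Measure (W × W)).map Prod.snd = μ := by
  let _ := TopologicalSpace.upgradeIsCompletelyMetrizable W
  have htight : IsTightMeasureSet {((ρ : ProbabilityMeasure (W × W)) : Measure (W × W)) |
      ρ ∈ Set.range π} := by
    have hν : IsTightMeasureSet {ν} := isTightMeasureSet_singleton
    have hμ : IsTightMeasureSet {μ} := isTightMeasureSet_singleton
    refine IsTightMeasureSet.prodMk (hν.subset ?_) (hμ.subset ?_)
    · rintro _ ⟨_, ⟨_, ⟨k, rfl⟩, rfl⟩, rfl⟩
      exact h₁ k
    · rintro _ ⟨_, ⟨_, ⟨k, rfl⟩, rfl⟩, rfl⟩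
      exact h₂ k
  have hcomp := isCompact_closure_of_isTightMeasureSet htight
  obtain ⟨π', -, φ, hφ, hlim⟩ := hcomp.isSeqCompact
    (fun k => subset_closure (Set.mem_range_self k) : ∀ k, π k ∈ closure (Set.range π))
  have hmarg : ∀ (f : W × W → W) (hf : Continuous f) (ρ : Measure W) [IsProbabilityMeasure ρ],
      (∀ k, (π k : Measure (W × W)).map f = ρ) → (π' : Measure (W × W)).map f = ρ := by
    intro f hf ρ hρ h
    have h1 := ProbabilityMeasure.tendsto_map_of_tendsto_of_continuous _ _ hlim hf
    have h2 : (fun k => ((π ∘ φ) k).map hf.measurable.aemeasurable) =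
        fun _ => (⟨ρ, hρ⟩ : ProbabilityMeasure W) := by
      funext k
      exact Subtype.ext (h (φ k))
    rw [h2] at h1
    exact congrArg (fun ρ : ProbabilityMeasure W => (ρ : Measure W))
      (tendsto_nhds_unique h1 tendsto_const_nhds)
  exact ⟨π', φ, hφ, hlim, hmarg _ continuous_fst ν h₁, hmarg _ continuous_snd μ h₂⟩

/-- For fixed `j`, the costs `d j` of the later couplings are dominated by their own costs `d k`;
let `k → ∞` along the subsequence, then `j → ∞`. -/
theorem transportCost_le_of_iSup_cost {W : Type*} [TopologicalSpace W] [PolishSpace W]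
    [MeasurableSpace W] [BorelSpace W] {ν μ : Measure W} [IsProbabilityMeasure ν]
    [IsProbabilityMeasure μ] (c : W → W → ℝ≥0∞) (d : ℕ → W × W → ℝ≥0∞)
    (hd : ∀ k, LowerSemicontinuous (d k)) (hmono : Monotone d)
    (hsup : ∀ p, ⨆ k, d k p = c p.1 p.2) (R : ℝ≥0∞)
    (h : ∀ k : ℕ, ∃ π : Measure (W × W), π.map Prod.fst = ν ∧ π.map Prod.snd = μ ∧
      ∫⁻ p, d k p ∂π ≤ R + ((k : ℝ≥0∞) + 1)⁻¹) :
    transportCost c ν μ ≤ R := by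
  choose π h₁ h₂ h₃ using h
  have hprob : ∀ k, IsProbabilityMeasure (π k) := by
    intro k
    constructor
    rw [← Set.preimage_univ (f := Prod.fst), ← Measure.map_apply measurable_fst .univ, h₁]
    simp
  obtain ⟨π', φ, hφ, hlim, h₁', h₂'⟩ :=
    exists_subseq_tendsto_of_couplings (fun k => ⟨π k, hprob k⟩) h₁ h₂
  refine (transportCost_le_of_le c _ h₁' h₂').trans ?_
  simp only [← hsup]
  rw [lintegral_iSup (fun k => (hd k).measurable) hmono]
  refine iSup_le fun j => ?_
  let _ := TopologicalSpace.upgradeIsCompletelyMetrizable W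
  refine (lintegral_le_liminf_of_lowerSemicontinuous (μs := fun k => π (φ k)) (hd j) fun G hG =>
    ProbabilityMeasure.le_liminf_measure_open_of_tendsto hlim hG).trans ?_
  have hto : Tendsto (fun k => R + ((φ k : ℝ≥0∞) + 1)⁻¹) atTop (𝓝 R) := by
    have h1 : Tendsto (fun k : ℕ => ((k : ℝ≥0∞) + 1)⁻¹) atTop (𝓝 0) := by
      have := ENNReal.tendsto_inv_nat_nhds_zero.comp (tendsto_add_atTop_nat 1)
      refine this.congr fun k => ?_
      simp
    simpa using tendsto_const_nhds.add (h1.comp hφ.tendsto_atTop)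
  rw [← hto.liminf_eq]
  refine liminf_le_liminf ?_
  filter_upwards [eventually_ge_atTop j] with k hk
  exact (lintegral_mono fun p => hmono (hk.trans hφ.le_apply) p).trans (h₃ (φ k))

/-! ### Monotone convex functions, Jensen's inequality and infimal convolution -/

theorem extendTop_coe (α : ℝ≥0 → ℝ≥0∞) (r : ℝ≥0) : extendTop α r = α r := by
  simp [extendTop]

theorem extendTop_top (α : ℝ≥0 → ℝ≥0∞) : extendTop α ⊤ = ⨆ r, α r := by
  simp [extendTop]

theorem extendTop_mono {α : ℝ≥0 → ℝ≥0∞} (hα : Monotone α) : Monotone (extendTop α) := by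
  intro s t hst
  induction t with
  | top =>
    rw [extendTop_top]
    induction s with
    | top => rw [extendTop_top]
    | coe s => rw [extendTop_coe]; exact le_iSup α s
  | coe t =>
    lift s to ℝ≥0 using (hst.trans_lt ENNReal.coe_lt_top).ne
    rw [extendTop_coe, extendTop_coe]
    exact hα (by exact_mod_cast hst)

theorem le_of_forall_lt_of_left_continuous {α : ℝ≥0 → ℝ≥0∞} (hα0 : α 0 = 0) {t : ℝ≥0}
    (hl : ContinuousWithinAt α (Set.Iic t) t) {B : ℝ≥0∞} (h : ∀ r < t, α r ≤ B) : α t ≤ B := by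
  rcases eq_or_ne t 0 with rfl | ht
  · simp [hα0]
  · have ht' : 0 < t := pos_iff_ne_zero.2 ht
    have : (𝓝[<] t).NeBot := nhdsLT_neBot_of_exists_lt ⟨0, ht'⟩
    exact le_of_tendsto (hl.mono Set.Iio_subset_Iic_self) (eventually_mem_nhdsWithin.mono h)

/-- Left continuity makes the supremum of a sublevel set attained, so it acts as a generalised
inverse of `α`. -/
theorem extendTop_sSup_le {α : ℝ≥0 → ℝ≥0∞} (hα : Monotone α) (hα0 : α 0 = 0)
    (hl : ∀ r, ContinuousWithinAt α (Set.Iic r) r) (B : ℝ≥0∞) :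
    extendTop α (sSup {r | extendTop α r ≤ B}) ≤ B := by
  have hlt : ∀ r : ℝ≥0, (r : ℝ≥0∞) < sSup {r | extendTop α r ≤ B} → α r ≤ B := by
    intro r hr
    obtain ⟨s, hs, hrs⟩ := lt_sSup_iff.1 hr
    rw [← extendTop_coe α]
    exact (extendTop_mono hα hrs.le).trans hs
  generalize sSup {r | extendTop α r ≤ B} = R at *
  induction R with
  | top =>
    rw [extendTop_top]
    exact iSup_le fun r => hlt r ENNReal.coe_lt_top
  | coe R =>
    rw [extendTop_coe]
    exact le_of_forall_lt_of_left_continuous hα0 (hl R) fun r hr => hlt r (by exact_mod_cast hr)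

/-- The slope is the supremum of the left slopes at `r`: finite because of the chord to `R`,
nonnegative by monotonicity. The products `a * s` and `a * r` are placed so as to avoid subtraction.
-/
theorem ConvexOn.exists_supporting_slope {α : ℝ≥0 → ℝ≥0∞} (hα : Monotone α)
    (hc : ConvexOn ℝ≥0 Set.univ α) {r R : ℝ≥0} (hr : 0 < r) (hrR : r < R) (hR : α R ≠ ⊤) :
    ∃ a : ℝ≥0, ∀ s : ℝ≥0, α r + a * s ≤ α s + a * r := by
  have hfin : ∀ s ≤ R, α s ≠ ⊤ := fun s hs => ((hα hs).trans_lt hR.lt_top).ne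
  have hrfin := hfin r hrR.le
  let A : ℝ≥0 → ℝ := fun s => (α s).toReal
  have hA : ∀ s, α s ≠ ⊤ → α s = ENNReal.ofReal (A s) := fun s hs => (ENNReal.ofReal_toReal hs).symm
  have hA0 : ∀ s, 0 ≤ A s := fun s => ENNReal.toReal_nonneg
  have slope : ∀ s < r, ∀ t, r < t → α t ≠ ⊤ →
      (A r - A s) / ((r : ℝ) - s) ≤ (A t - A r) / ((t : ℝ) - r) := by
    intro s hs t ht htop
    have hst : s < t := hs.trans ht
    have hs' : (s : ℝ) < r := hs
    have ht' : (r : ℝ) < t := ht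
    have hd : (0 : ℝ) < t - s := by linarith
    have hd' : t - s ≠ 0 := (tsub_pos_of_lt hst).ne'
    have hp : (t - r) / (t - s) + (r - s) / (t - s) = 1 := by
      rw [← add_div, tsub_add_tsub_cancel ht.le hs.le, div_self hd']
    have hcomb : ((t - r) / (t - s)) • s + ((r - s) / (t - s)) • t = r := by
      apply NNReal.coe_injective
      push_cast [NNReal.coe_sub ht.le, NNReal.coe_sub hs.le, NNReal.coe_sub hst.le, smul_eq_mul]
      field_simp
      ring
    have h := hc.2 (Set.mem_univ s) (Set.mem_univ t) (zero_le (a := (t - r) / (t - s)))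
      (zero_le (a := (r - s) / (t - s))) hp
    rw [hcomb] at h
    have h2 : A r ≤ ((t : ℝ) - r) / (t - s) * A s + ((r : ℝ) - s) / (t - s) * A t := by
      have h3 := ENNReal.toReal_mono (ENNReal.add_ne_top.2
        ⟨ENNReal.mul_ne_top ENNReal.coe_ne_top (hfin s (hs.trans hrR).le),
          ENNReal.mul_ne_top ENNReal.coe_ne_top htop⟩) h
      rw [ENNReal.toReal_add (ENNReal.mul_ne_top ENNReal.coe_ne_top (hfin s (hs.trans hrR).le))
        (ENNReal.mul_ne_top ENNReal.coe_ne_top htop)] at h3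
      simpa [ENNReal.smul_def, ENNReal.toReal_mul, NNReal.coe_sub ht.le, NNReal.coe_sub hs.le,
        NNReal.coe_sub hst.le] using h3
    rw [div_le_div_iff₀ (by linarith) (by linarith)]
    have h4 := mul_le_mul_of_nonneg_left h2 hd.le
    have h5 : ((t : ℝ) - s) * (((t : ℝ) - r) / (t - s) * A s + ((r : ℝ) - s) / (t - s) * A t) =
        (t - r) * A s + (r - s) * A t := by
      field_simp
    rw [h5] at h4
    linarith
  let S : Set ℝ := {q | ∃ s < r, q = (A r - A s) / ((r : ℝ) - s)}
  have hbdd : BddAbove S := ⟨_, by rintro _ ⟨s, hs, rfl⟩; exact slope s hs R hrR hR⟩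
  have hne : S.Nonempty := ⟨_, 0, hr, rfl⟩
  have ha0 : 0 ≤ sSup S := by
    refine le_csSup_of_le hbdd ⟨0, hr, rfl⟩ (div_nonneg ?_ (by simp))
    exact sub_nonneg.2 (ENNReal.toReal_mono hrfin (hα zero_le))
  refine ⟨(sSup S).toNNReal, fun s => ?_⟩
  by_cases hs : α s = ⊤
  · simp [hs]
  have hreal : A r + sSup S * s ≤ A s + sSup S * r := by
    rcases lt_trichotomy s r with h | rfl | h
    · have h1 : (A r - A s) / ((r : ℝ) - s) ≤ sSup S := le_csSup hbdd ⟨s, h, rfl⟩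
      have h' : (s : ℝ) < r := h
      rw [div_le_iff₀ (by linarith)] at h1
      linarith
    · exact le_rfl
    · have h1 : sSup S ≤ (A s - A r) / ((s : ℝ) - r) :=
        csSup_le hne (by rintro _ ⟨q, hq, rfl⟩; exact slope q hq s h hs)
      have h' : (r : ℝ) < s := h
      rw [le_div_iff₀ (by linarith)] at h1
      linarith
  have hco : ((sSup S).toNNReal : ℝ≥0∞) = ENNReal.ofReal (sSup S) := rfl
  rw [hA r hrfin, hA s hs, hco, ← ENNReal.ofReal_coe_nnreal (p := s),
    ← ENNReal.ofReal_coe_nnreal (p := r), ← ENNReal.ofReal_mul ha0, ← ENNReal.ofReal_mul ha0,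
    ← ENNReal.ofReal_add (hA0 _) (mul_nonneg ha0 s.coe_nonneg),
    ← ENNReal.ofReal_add (hA0 _) (mul_nonneg ha0 r.coe_nonneg)]
  exact ENNReal.ofReal_le_ofReal hreal

/-- Jensen's inequality when `α` may take the value `∞`. By left continuity it is enough to bound `α
r` for `r < t`, where a supporting line exists. -/
theorem ConvexOn.map_lintegral_le {Y : Type*} [MeasurableSpace Y] (ρ : Measure Y)
    [IsProbabilityMeasure ρ] {α : ℝ≥0 → ℝ≥0∞} (hα : Monotone α)
    (hl : ∀ r, ContinuousWithinAt α (Set.Iic r) r) (hα0 : α 0 = 0)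
    (hc : ConvexOn ℝ≥0 Set.univ α) (τ : Y → ℝ≥0) (hτ : Measurable τ) (t : ℝ≥0)
    (ht : ∫⁻ y, τ y ∂ρ = t) : α t ≤ ∫⁻ y, α (τ y) ∂ρ := by
  have hατ : Measurable fun y => α (τ y) := hα.measurable.comp hτ
  refine le_of_forall_lt_of_left_continuous hα0 (hl t) fun r hr => ?_
  rcases eq_or_ne r 0 with rfl | hr0
  · simp [hα0]
  by_cases htop : ∫⁻ y, α (τ y) ∂ρ = ⊤
  · simp [htop]
  -- Otherwise `τ ≤ r` almost everywhere and its mean could not be `t > r`; the value `τ y` serves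
  -- as the point `R` beyond `r`.
  obtain ⟨y, hy, hyr⟩ : ∃ y, α (τ y) < ⊤ ∧ r < τ y := by
    by_contra! hcon
    have hle : ∀ᵐ y ∂ρ, (τ y : ℝ≥0∞) ≤ r := by
      filter_upwards [ae_lt_top hατ htop] with y hy
      exact_mod_cast hcon y hy
    have := lintegral_mono_ae hle
    rw [ht, lintegral_const, measure_univ, mul_one] at this
    exact absurd hr (not_lt.2 (by exact_mod_cast this))
  obtain ⟨a, ha⟩ := ConvexOn.exists_supporting_slope hα hc (pos_iff_ne_zero.2 hr0) hyr hy.ne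
  have h1 : α r + a * t ≤ ∫⁻ y, α (τ y) ∂ρ + a * t := by
    calc α r + a * t = ∫⁻ y, (α r + a * τ y) ∂ρ := by
          rw [lintegral_add_left measurable_const, lintegral_const_mul _ hτ.coe_nnreal_ennreal, ht]
          simp
      _ ≤ ∫⁻ y, (α (τ y) + a * r) ∂ρ := lintegral_mono fun y => ha (τ y)
      _ = ∫⁻ y, α (τ y) ∂ρ + a * r := by
          rw [lintegral_add_left hατ]
          simp
      _ ≤ ∫⁻ y, α (τ y) ∂ρ + a * t := by gcongr
  exact (ENNReal.add_le_add_iff_right (ENNReal.mul_ne_top ENNReal.coe_ne_top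
    ENNReal.coe_ne_top)).1 h1

theorem exists_nnreal_le_sum_eq {n : ℕ} (T : ℝ≥0) (r : Fin n → ℝ≥0∞) (h : (T : ℝ≥0∞) ≤ ∑ i, r i) :
    ∃ s : Fin n → ℝ≥0, (∀ i, (s i : ℝ≥0∞) ≤ r i) ∧ ∑ i, s i = T := by
  have hq : ∀ i, ∃ q : ℝ≥0, (q : ℝ≥0∞) = min (r i) T := fun i =>
    ⟨_, ENNReal.coe_toNNReal ((min_le_right _ _).trans_lt ENNReal.coe_lt_top).ne⟩
  choose q hq using hq
  have hsum : T ≤ ∑ i, q i := by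
    by_cases hall : ∀ i, r i ≤ T
    · have : ∀ i, (q i : ℝ≥0∞) = r i := fun i => by rw [hq, min_eq_left (hall i)]
      have h' : (T : ℝ≥0∞) ≤ ∑ i, (q i : ℝ≥0∞) := by simpa only [this] using h
      exact_mod_cast h'
    · push Not at hall
      obtain ⟨i, hi⟩ := hall
      have : q i = T := by
        have := hq i
        rw [min_eq_right hi.le] at this
        exact_mod_cast this
      rw [← this]
      exact Finset.single_le_sum (f := q) (fun _ _ => zero_le) (Finset.mem_univ i)
  rcases eq_or_ne (∑ i, q i) 0 with h0 | h0
  · exact ⟨fun _ => 0, fun i => by simp, by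
      rw [h0] at hsum; simpa using (nonpos_iff_eq_zero.1 hsum).symm⟩
  -- Scale the finite truncations `min(rᵢ, T)` down proportionally until they sum to `T`.
  · refine ⟨fun i => q i * (T / ∑ i, q i), fun i => ?_, ?_⟩
    · have h1 : q i * (T / ∑ i, q i) ≤ q i := mul_le_of_le_one_right' (div_le_one_of_le₀ hsum zero_le)
      exact (ENNReal.coe_le_coe.2 h1).trans ((hq i).le.trans (min_le_left _ _))
    · rw [← Finset.sum_mul, mul_div_cancel₀ _ h0]

theorem infConv_le_sum_extendTop {n : ℕ} (α : Fin n → ℝ≥0 → ℝ≥0∞) (hα : ∀ i, Monotone (α i))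
    (T : ℝ≥0) (r : Fin n → ℝ≥0∞) (h : (T : ℝ≥0∞) ≤ ∑ i, r i) :
    infConv α T ≤ ∑ i, extendTop (α i) (r i) := by
  obtain ⟨s, hs, hsum⟩ := exists_nnreal_le_sum_eq T r h
  refine (iInf₂_le s hsum).trans (Finset.sum_le_sum fun i _ => ?_)
  rw [← extendTop_coe (α i)]
  exact extendTop_mono (hα i) (hs i)

theorem extendTop_infConv_le {n : ℕ} (α : Fin n → ℝ≥0 → ℝ≥0∞) (hα : ∀ i, Monotone (α i))
    (T : ℝ≥0∞) (r : Fin n → ℝ≥0∞) (h : T ≤ ∑ i, r i) :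
    extendTop (infConv α) T ≤ ∑ i, extendTop (α i) (r i) := by
  induction T with
  | top =>
    rw [extendTop_top]
    exact iSup_le fun t => infConv_le_sum_extendTop α hα t r (le_top.trans h)
  | coe T =>
    rw [extendTop_coe]
    exact infConv_le_sum_extendTop α hα T r h

/-! ### Conditional information and the coupling of one coordinate -/

/-- The root of `g² / a` is `g / √a` since `g ≥ 0`, and the form is quadratic. -/
theorem DirichletForm.fisherInfo_withDensity_sq_le {X : Type*} [MeasurableSpace X] {m : Measure X}
    [IsProbabilityMeasure m] (E : DirichletForm m) (g : X → ℝ) (hg : Measurable g)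
    (hmem : E.toL2Energy.Mem g) (hg0 : ∀ᵐ x ∂m, 0 ≤ g x) (a : ℝ≥0∞) (ha0 : a ≠ 0) (ha : a ≠ ⊤) :
    fisherInfo E.toL2Energy (m.withDensity fun x => ENNReal.ofReal (g x ^ 2) / a) ≤
      a⁻¹ * E.toL2Energy.eval g := by
  obtain ⟨hL, hdom⟩ := hmem
  set u : X → ℝ≥0∞ := fun x => ENNReal.ofReal (g x ^ 2) / a with hu
  have hum : Measurable u := (hg.pow_const 2).ennreal_ofReal.div_const a
  let s : ℝ := √(a.toReal⁻¹)
  have hs : s * s = a.toReal⁻¹ := Real.mul_self_sqrt (inv_nonneg.2 ENNReal.toReal_nonneg)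
  have hsqrt : sqrtDensity (m.withDensity u) m =ᵐ[m] s • g := by
    filter_upwards [Measure.rnDeriv_withDensity m hum, hg0] with x hx hx0
    simp only [sqrtDensity, Pi.smul_apply, smul_eq_mul]
    rw [hx, hu, ENNReal.toReal_div, ENNReal.toReal_ofReal (sq_nonneg _), div_eq_inv_mul,
      Real.sqrt_mul (inv_nonneg.2 ENNReal.toReal_nonneg), Real.sqrt_sq hx0]
  have hL' : MemLp (sqrtDensity (m.withDensity u) m) 2 m :=
    (memLp_congr_ae hsqrt).2 (hL.const_smul s)
  have htoLp : hL'.toLp _ = s • hL.toLp g := by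
    rw [← MemLp.toLp_const_smul]
    exact (MemLp.toLp_eq_toLp_iff _ _).2 hsqrt
  have hdom0 : hL.toLp g ∈ E.domain := hdom
  have hdom' : hL'.toLp _ ∈ E.domain := by
    rw [htoLp]
    exact E.domain.smul_mem s hdom0
  have hac : m.withDensity u ≪ m ∧ E.toL2Energy.Mem (sqrtDensity (m.withDensity u) m) :=
    ⟨withDensity_absolutelyContinuous _ _, hL', hdom'⟩
  have hsub : (⟨hL'.toLp _, hdom'⟩ : E.domain) = s • ⟨hL.toLp g, hdom0⟩ := Subtype.ext htoLp
  rw [fisherInfo, if_pos hac, L2Energy.eval, L2Energy.eval, dif_pos hL', dif_pos hL]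
  simp only [DirichletForm.toL2Energy]
  rw [dif_pos hdom', dif_pos hdom0, hsub, map_smul, map_smul, LinearMap.smul_apply, smul_eq_mul,
    smul_eq_mul, ← mul_assoc, hs, ENNReal.ofReal_mul (inv_nonneg.2 ENNReal.toReal_nonneg),
    ENNReal.ofReal_inv_of_pos (ENNReal.toReal_pos ha0 ha), ENNReal.ofReal_toReal ha]

/-- Draw the other coordinates from their law under `ν`, then `(xᵢ, yᵢ)` from a near-optimal
coupling of the conditional law with `μᵢ`. As the second marginal is always `μᵢ`, `yᵢ` is
independent of the other coordinates. -/
theorem exists_coordinate_coupling {n : ℕ} {X : Fin n → Type*} [∀ i, MeasurableSpace (X i)]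
    (μ : ∀ i, Measure (X i)) [∀ i, IsProbabilityMeasure (μ i)] (i : Fin n)
    [MeasurableSpace.CountablyGenerated (X i)] (E : DirichletForm (μ i))
    (c : X i → X i → ℝ≥0∞) (hc : Measurable fun p : X i × X i => c p.1 p.2) (C : ℝ≥0)
    (hcC : ∀ x y, c x y ≤ C) (α : ℝ≥0 → ℝ≥0∞) (hα : Monotone α)
    (hl : ∀ r, ContinuousWithinAt α (Set.Iic r) r) (hα0 : α 0 = 0)
    (hconv : ConvexOn ℝ≥0 Set.univ α)
    (hTI : ∀ ν : Measure (X i), IsProbabilityMeasure ν →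
      extendTop α (transportCost c ν (μ i)) ≤ fisherInfo E.toL2Energy ν)
    (G : (∀ j, X j) → ℝ) (hG : Measurable G) (hG0 : ∀ᵐ x ∂(Measure.pi μ), 0 ≤ G x)
    (hGmem : ∀ᵐ x ∂(Measure.pi μ), E.toL2Energy.Mem (coordSection G i x))
    (ν : Measure (∀ j, X j)) [IsProbabilityMeasure ν]
    (hν : ν = (Measure.pi μ).withDensity fun x => ENNReal.ofReal (G x ^ 2))
    (R : ℝ≥0∞) (hR : ∀ t : ℝ≥0, α t ≤ ∫⁻ x, E.toL2Energy.eval (coordSection G i x) ∂(Measure.pi μ) →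
      (t : ℝ≥0∞) ≤ R)
    {ε : ℝ≥0∞} (hε : ε ≠ 0) :
    ∃ P : Measure ((∀ j, X j) × X i), P.map Prod.fst = ν ∧
      (∀ h : (∀ j, X j) → ℝ≥0∞, Measurable h → DependsOn h {i}ᶜ →
        ∀ g : X i → ℝ≥0∞, Measurable g →
          ∫⁻ p, h p.1 * g p.2 ∂P = (∫⁻ x, g x ∂(μ i)) * ∫⁻ x, h x ∂ν) ∧
      ∫⁻ p, c (p.1 i) p.2 ∂P ≤ R + ε := by
  have hup := measurePreserving_update μ i
  set ρ := Measure.pi μ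
  let F : (∀ j, X j) → X i → ℝ≥0∞ := fun y t => ENNReal.ofReal (G (Function.update y i t) ^ 2)
  have hF : Measurable fun q : (∀ j, X j) × X i => F q.1 q.2 :=
    ((hG.comp hup.measurable).pow_const 2).ennreal_ofReal
  have hFy : ∀ y, Measurable (F y) := fun y => Measurable.of_uncurry_left (f := F) hF
  let a : (∀ j, X j) → ℝ≥0∞ := fun y => ∫⁻ t, F y t ∂(μ i)
  have ha : Measurable a := hF.lintegral_prod_right'
  have hresample : ∀ g : (∀ j, X j) → ℝ≥0∞, Measurable g →
      ∫⁻ y, ∫⁻ t, g (Function.update y i t) * F y t ∂(μ i) ∂ρ = ∫⁻ x, g x ∂ν := by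
    intro g hg
    have hGm : Measurable fun x => ENNReal.ofReal (G x ^ 2) := (hG.pow_const 2).ennreal_ofReal
    rw [hν, lintegral_withDensity_eq_lintegral_mul _ hGm hg, ← hup.lintegral_comp (hGm.mul hg),
      ← lintegral_prod (fun q : (∀ j, X j) × X i => g (Function.update q.1 i q.2) * F q.1 q.2)
        ((hg.comp hup.measurable).mul hF).aemeasurable]
    refine lintegral_congr fun q => ?_
    simp only [Pi.mul_apply, F, mul_comm]
  have ha1 : ∫⁻ y, a y ∂ρ = 1 := by
    have := hresample (fun _ => 1) measurable_const
    simpa using this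
  have hatop : ∀ᵐ y ∂ρ, a y < ⊤ := ae_lt_top ha (by simp [ha1])
  let bad : Set (∀ j, X j) := {y | a y = 0 ∨ a y = ⊤}
  have hbad : MeasurableSet bad :=
    (ha (measurableSet_singleton 0)).union (ha (measurableSet_singleton ⊤))
  classical
  -- The default `1` keeps `u y` a probability density for every `y`; `bad` is null for the weighted
  -- measure `a ρ`.
  let u : (∀ j, X j) → X i → ℝ≥0∞ := fun y t => if y ∈ bad then 1 else F y t / a y
  have hu : Measurable (Function.uncurry u) :=
    Measurable.ite (measurable_fst hbad) measurable_const (hF.div (ha.comp measurable_fst))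
  have huy : ∀ y, Measurable (u y) := fun y => Measurable.of_uncurry_left hu
  have hu1 : ∀ y, ∫⁻ t, u y t ∂(μ i) = 1 := by
    intro y
    by_cases hy : y ∈ bad
    · simp [u, hy]
    · simp only [u, hy, if_false]
      simp only [bad, Set.mem_ofPred_eq, not_or] at hy
      simp only [div_eq_mul_inv]
      rw [lintegral_mul_const _ (hFy y)]
      exact ENNReal.mul_inv_cancel hy.1 hy.2
  have hau : ∀ᵐ y ∂ρ, ∀ᵐ t ∂(μ i), a y * u y t = F y t := by
    filter_upwards [hatop] with y hy
    by_cases h0 : a y = 0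
    · filter_upwards [(lintegral_eq_zero_iff (hFy y)).1 h0] with t ht
      rw [h0, zero_mul, ht, Pi.zero_apply]
    · have hb : y ∉ bad := by simp [bad, h0, hy.ne]
      refine .of_forall fun t => ?_
      simp only [u, hb, if_false]
      exact ENNReal.mul_div_cancel h0 hy.ne
  obtain ⟨K, hK⟩ := exists_kernel_coupling_le_transportCost (μ i) c hc C hcC u hu hu1 hε
  have hKm : IsMarkovKernel K := ⟨fun y => ⟨by
    rw [← Set.preimage_univ (f := Prod.snd), ← Measure.map_apply measurable_snd .univ, (hK y).2.1]
    simp⟩⟩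
  have hKfst : ∀ y (g : X i → ℝ≥0∞), Measurable g →
      ∫⁻ p, g p.1 ∂(K y) = ∫⁻ t, u y t * g t ∂(μ i) := by
    intro y g hg
    rw [← lintegral_map hg measurable_fst, (hK y).1,
      lintegral_withDensity_eq_lintegral_mul _ (huy y) hg]
    rfl
  have hKsnd : ∀ y (g : X i → ℝ≥0∞), Measurable g → ∫⁻ p, g p.2 ∂(K y) = ∫⁻ t, g t ∂(μ i) := by
    intro y g hg
    rw [← lintegral_map hg measurable_snd, (hK y).2.1]
  -- Under `ρ'` the coordinates other than `i` have the same law as under `ν`, and the `i`-th one is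
  -- a dummy that is overwritten.
  let ρ' : Measure (∀ j, X j) := ρ.withDensity a
  have hρ' : IsProbabilityMeasure ρ' := isProbabilityMeasure_withDensity_of_lintegral ha1
  have hρ'int : ∀ g : (∀ j, X j) → ℝ≥0∞, Measurable g → ∫⁻ y, g y ∂ρ' = ∫⁻ y, a y * g y ∂ρ :=
    fun g hg => lintegral_withDensity_eq_lintegral_mul _ ha hg
  let ι : (∀ j, X j) × (X i × X i) → (∀ j, X j) × X i :=
    fun q => (Function.update q.1 i q.2.1, q.2.2)
  have hι : Measurable ι :=
    (hup.measurable.comp (measurable_fst.prodMk (measurable_fst.comp measurable_snd))).prodMk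
      (measurable_snd.comp measurable_snd)
  let P : Measure ((∀ j, X j) × X i) := (ρ' ⊗ₘ K).map ι
  have hP : ∀ f : (∀ j, X j) × X i → ℝ≥0∞, Measurable f →
      ∫⁻ p, f p ∂P = ∫⁻ y, ∫⁻ p, f (Function.update y i p.1, p.2) ∂(K y) ∂ρ' := by
    intro f hf
    rw [lintegral_map hf hι, Measure.lintegral_compProd (f := fun q => f (ι q)) (hf.comp hι)]
  have hupy : ∀ y : (∀ j, X j), Measurable fun t : X i => Function.update y i t := fun y =>
    hup.measurable.comp measurable_prodMk_left
  have hPfst : P.map Prod.fst = ν := by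
    refine Measure.ext_of_lintegral _ fun g hg => ?_
    rw [lintegral_map hg measurable_fst, hP (fun p => g p.1) (hg.comp measurable_fst), hρ'int _ ?_,
      ← hresample g hg]
    · refine lintegral_congr_ae ?_
      filter_upwards [hau] with y hy
      rw [hKfst y (fun t => g (Function.update y i t)) (hg.comp (hupy y)),
        ← lintegral_const_mul (f := fun t => u y t * g (Function.update y i t)) _
          ((huy y).mul (hg.comp (hupy y)))]
      refine lintegral_congr_ae ?_
      filter_upwards [hy] with t ht
      rw [← mul_assoc, ht, mul_comm]
    · exact ((hg.comp measurable_fst).comp hι).lintegral_kernel_prod_right'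
  have hinv : ∀ h : (∀ j, X j) → ℝ≥0∞, DependsOn h {i}ᶜ → ∀ y t, h (Function.update y i t) = h y :=
    fun h hh y t => hh fun j hj => Function.update_of_ne (by simpa using hj) _ _
  have hPind : ∀ h : (∀ j, X j) → ℝ≥0∞, Measurable h → DependsOn h {i}ᶜ →
      ∀ g : X i → ℝ≥0∞, Measurable g →
        ∫⁻ p, h p.1 * g p.2 ∂P = (∫⁻ x, g x ∂(μ i)) * ∫⁻ y, h y ∂ρ' := by
    intro h hh hdep g hg
    rw [hP (fun p => h p.1 * g p.2) ((hh.comp measurable_fst).mul (hg.comp measurable_snd)), ← lintegral_const_mul _ hh]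
    refine lintegral_congr fun y => ?_
    simp only [hinv h hdep]
    rw [lintegral_const_mul (f := fun p : X i × X i => g p.2) _ (hg.comp measurable_snd), hKsnd y g hg, mul_comm]
  refine ⟨P, hPfst, fun h hh hdep g hg => ?_, ?_⟩
  · rw [hPind h hh hdep g hg]
    congr 1
    have := hPind h hh hdep (fun _ => 1) measurable_const
    simp only [mul_one, lintegral_one, measure_univ, one_mul] at this
    rw [← this, ← hPfst, lintegral_map hh measurable_fst]
  · let τ : (∀ j, X j) → ℝ≥0∞ := fun y => ∫⁻ p, c p.1 p.2 ∂(K y)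
    have hτ : Measurable τ := hc.lintegral_kernel
    have hτC : ∀ y, τ y ≤ C := fun y =>
      (lintegral_mono (g := fun _ => (C : ℝ≥0∞)) fun p : X i × X i => hcC p.1 p.2).trans (by simp)
    -- Removing `ε` before applying `α` leaves a quantity below the conditional transport cost, so
    -- no continuity of `α` from the right is needed.
    let τ' : (∀ j, X j) → ℝ≥0 := fun y => (τ y - ε).toNNReal
    have hτ' : Measurable τ' := (hτ.sub_const ε).ennreal_toNNReal
    have hτ'C : ∀ y, (τ' y : ℝ≥0∞) = τ y - ε := fun y =>
      ENNReal.coe_toNNReal ((tsub_le_self.trans (hτC y)).trans_lt ENNReal.coe_lt_top).ne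
    have htfin : ∫⁻ y, τ' y ∂ρ' ≠ ⊤ := by
      refine ((lintegral_mono (g := fun _ => (C : ℝ≥0∞)) fun y => ?_).trans_lt ?_).ne
      · rw [hτ'C]; exact tsub_le_self.trans (hτC y)
      · simp
    lift ∫⁻ y, τ' y ∂ρ' to ℝ≥0 using htfin with t ht
    have hαt : α t ≤ ∫⁻ x, E.toL2Energy.eval (coordSection G i x) ∂ρ := by
      refine (ConvexOn.map_lintegral_le ρ' hα hl hα0 hconv τ' hτ' t ht.symm).trans ?_
      rw [hρ'int (fun y => α (τ' y)) (hα.measurable.comp hτ')]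
      refine lintegral_mono_ae ?_
      have hG0' : ∀ᵐ y ∂ρ, ∀ᵐ t ∂(μ i), 0 ≤ G (Function.update y i t) :=
        Measure.ae_ae_of_ae_prod (hup.quasiMeasurePreserving.ae hG0)
      filter_upwards [hatop, hGmem, hG0'] with y hy hmem hpos
      by_cases h0 : a y = 0
      · simp [h0]
      have hb : y ∉ bad := by simp [bad, h0, hy.ne]
      have huF : u y = fun t => ENNReal.ofReal (coordSection G i y t ^ 2) / a y := by
        funext t
        simp only [u, hb, if_false]
        rfl
      have h1 : α (τ' y) ≤ (a y)⁻¹ * E.toL2Energy.eval (coordSection G i y) := by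
        rw [← extendTop_coe α, hτ'C]
        have hprob := isProbabilityMeasure_withDensity_of_lintegral (hu1 y)
        refine (extendTop_mono hα (tsub_le_iff_right.2 (hK y).2.2)).trans ((hTI _ hprob).trans ?_)
        rw [huF]
        exact E.fisherInfo_withDensity_sq_le _ (hG.comp (hupy y)) hmem hpos _ h0 hy.ne
      calc a y * α (τ' y) ≤ a y * ((a y)⁻¹ * E.toL2Energy.eval (coordSection G i y)) := by gcongr
        _ = E.toL2Energy.eval (coordSection G i y) := by
            rw [← mul_assoc, ENNReal.mul_inv_cancel h0 hy.ne, one_mul]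
    have hcm : Measurable fun p : (∀ j, X j) × X i => c (p.1 i) p.2 :=
      hc.comp (f := fun p : (∀ j, X j) × X i => (p.1 i, p.2)) (by fun_prop)
    rw [hP _ hcm]
    simp only [Function.update_self]
    calc ∫⁻ y, τ y ∂ρ' ≤ ∫⁻ y, (τ' y + ε) ∂ρ' :=
          lintegral_mono fun y => by rw [hτ'C]; exact le_tsub_add
      _ = t + ε := by rw [lintegral_add_right _ measurable_const, ← ht]; simp
      _ ≤ R + ε := by gcongr; exact hR t hαt

/-! ### Assembly of the tensorization -/

/-- Superadditivity of the lower integral; it spares any measurability of the section energies. -/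
theorem sum_lintegral_le_lintegral_sum {Y ι : Type*} [MeasurableSpace Y] (ρ : Measure Y)
    (s : Finset ι) (f : ι → Y → ℝ≥0∞) :
    ∑ i ∈ s, ∫⁻ y, f i y ∂ρ ≤ ∫⁻ y, ∑ i ∈ s, f i y ∂ρ := by
  classical
  induction s using Finset.induction_on with
  | empty => simp
  | insert i s hi ih =>
    simp only [Finset.sum_insert hi]
    exact (add_le_add le_rfl ih).trans (le_lintegral_add _ _)

theorem transportCost_mono {X : Type*} [MeasurableSpace X] {c d : X → X → ℝ≥0∞}
    (h : ∀ x y, c x y ≤ d x y) (ν μ : Measure X) : transportCost c ν μ ≤ transportCost d ν μ :=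
  iInf_mono fun _ => iInf_mono fun _ => iInf_mono fun _ => lintegral_mono fun p => h p.1 p.2

theorem theorem2p4 {n : ℕ} {X : Fin n → Type*}
    [∀ i, TopologicalSpace (X i)] [∀ i, PolishSpace (X i)]
    [∀ i, MeasurableSpace (X i)] [∀ i, BorelSpace (X i)]
    (μ : ∀ i, Measure (X i)) [∀ i, IsProbabilityMeasure (μ i)]
    (E : ∀ i, DirichletForm (μ i))
    (c : ∀ i, X i → X i → ℝ≥0∞)
    (hc_lsc : ∀ i, LowerSemicontinuous (fun p : X i × X i => c i p.1 p.2))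
    (hc_diag : ∀ i x, c i x x = 0)
    (α : Fin n → ℝ≥0 → ℝ≥0∞)
    (hα_mono : ∀ i, Monotone (α i))
    (hα_left : ∀ i r, ContinuousWithinAt (α i) (Set.Iic r) r)
    (hα_zero : ∀ i, α i 0 = 0)
    (hα_convex : ∀ i, ConvexOn ℝ≥0 Set.univ (α i))
    (hTI : ∀ i (ν : Measure (X i)), IsProbabilityMeasure ν →
      extendTop (α i) (transportCost (c i) ν (μ i)) ≤ fisherInfo (E i).toL2Energy ν)
    (ν : Measure (∀ i, X i)) [IsProbabilityMeasure ν] :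
    extendTop (infConv α) (transportCost (sumCost c) ν (Measure.pi μ)) ≤
      fisherInfo (sumForm fun i => (E i).toL2Energy) ν := by
  by_cases hfin : ν ≪ Measure.pi μ ∧
      (sumForm fun i => (E i).toL2Energy).Mem (sqrtDensity ν (Measure.pi μ))
  swap
  · rw [fisherInfo, if_neg hfin]; exact le_top
  rw [fisherInfo, if_pos hfin]
  obtain ⟨hac, hL, hdom, -⟩ := hfin
  rw [L2Energy.eval, dif_pos hL]
  -- The sum form evaluates sections of this very representative of the class.
  set G : (∀ i, X i) → ℝ := ⇑(hL.toLp (sqrtDensity ν (Measure.pi μ)))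
  have hG : Measurable G := (Lp.stronglyMeasurable _).measurable
  have hGeq : G =ᵐ[Measure.pi μ] sqrtDensity ν (Measure.pi μ) := hL.coeFn_toLp
  have hG0 : ∀ᵐ x ∂(Measure.pi μ), 0 ≤ G x := by
    filter_upwards [hGeq] with x hx
    rw [hx]; exact Real.sqrt_nonneg _
  have hν : ν = (Measure.pi μ).withDensity fun x => ENNReal.ofReal (G x ^ 2) := by
    refine (Measure.withDensity_rnDeriv_eq ν (Measure.pi μ) hac).symm.trans
      (withDensity_congr_ae ?_)
    filter_upwards [hGeq, Measure.rnDeriv_lt_top ν (Measure.pi μ)] with x hx hx'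
    rw [hx, sqrtDensity,
      Real.sq_sqrt ENNReal.toReal_nonneg, ENNReal.ofReal_toReal hx'.ne]
  let B : Fin n → ℝ≥0∞ := fun i =>
    ∫⁻ x, (E i).toL2Energy.eval (coordSection G i x) ∂(Measure.pi μ)
  let R : Fin n → ℝ≥0∞ := fun i => sSup {r | extendTop (α i) r ≤ B i}
  have hRB : ∀ i, extendTop (α i) (R i) ≤ B i := fun i =>
    extendTop_sSup_le (hα_mono i) (hα_zero i) (hα_left i) (B i)
  suffices hT : transportCost (sumCost c) ν (Measure.pi μ) ≤ ∑ i, R i from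
    (extendTop_infConv_le α hα_mono _ R hT).trans ((Finset.sum_le_sum fun i _ => hRB i).trans
      (sum_lintegral_le_lintegral_sum _ _ _))
  let b : ∀ i, ℕ → X i → X i → ℝ≥0∞ := fun i k x y => min (c i x y) k
  have hb_lsc : ∀ i k, LowerSemicontinuous fun p : X i × X i => b i k p.1 p.2 := fun i k =>
    (hc_lsc i).inf lowerSemicontinuous_const
  have hb_mono : ∀ i x y, Monotone fun k => b i k x y := fun i x y k l hkl =>
    min_le_min le_rfl (by exact_mod_cast hkl)
  have hb_sup : ∀ i x y, ⨆ k, b i k x y = c i x y := by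
    intro i x y
    have := (inf_iSup_eq (c i x y) (fun k : ℕ => (k : ℝ≥0∞))).symm
    rwa [ENNReal.iSup_natCast, inf_top_eq] at this
  refine transportCost_le_of_iSup_cost (sumCost c)
    (fun k p => ∑ i, b i k (p.1 i) (p.2 i)) (fun k => ?_) (fun k l hkl p => ?_) (fun p => ?_) _
    (fun k => ?_)
  · refine lowerSemicontinuous_sum fun i _ => ?_
    exact (hb_lsc i k).comp
      (g := fun p : (∀ j, X j) × (∀ j, X j) => (p.1 i, p.2 i)) (by fun_prop)
  · exact Finset.sum_le_sum fun i _ => hb_mono i _ _ hkl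
  · rw [← ENNReal.finsetSum_iSup_of_monotone fun i => hb_mono i _ _]
    simp only [hb_sup, sumCost]
  -- Dividing by `n + 1` instead of `n` also covers `n = 0`.
  · let ε : ℝ≥0∞ := ((k : ℝ≥0∞) + 1)⁻¹ / (n + 1)
    have hε : ε ≠ 0 := by
      refine (ENNReal.div_pos ?_ ?_).ne'
      · exact ENNReal.inv_ne_zero.2 (by finiteness)
      · finiteness
    choose P hP₁ hP₂ hP₃ using fun i => exists_coordinate_coupling μ i (E i) (b i k)
      (hb_lsc i k).measurable k (fun x y => by simp [b]) (α i) (hα_mono i) (hα_left i)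
      (hα_zero i) (hα_convex i)
      (fun ν' hν' => (extendTop_mono (hα_mono i)
        (transportCost_mono (fun x y => min_le_left _ _) _ _)).trans (hTI i ν' hν'))
      G hG hG0 (hdom i) ν hν (R i)
      (fun t ht => le_sSup (by simpa only [Set.mem_ofPred_eq, extendTop_coe] using ht)) hε
    choose κ hκm hκdep hκ using fun i => exists_adapted_kernel ν i (P i) (hP₁ i)
    obtain ⟨π, hπ₁, hπ₂, hπ₃⟩ := exists_coupling_of_adapted_kernels μ ν κ hκdep
      (fun i h hh hdep s hs => by
        have hs1 : Measurable (s.indicator fun _ => (1 : ℝ≥0∞)) := measurable_const.indicator hs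
        have h1 := hP₂ i h hh
          (fun x y hxy => hdep fun j hj => hxy j (by simpa using (Set.mem_Iio.1 hj).ne)) _ hs1
        rw [lintegral_indicator_const hs, one_mul] at h1
        rw [← h1, ← hκ i (fun p => h p.1 * s.indicator (fun _ => 1) p.2)
          ((hh.comp measurable_fst).mul (hs1.comp measurable_snd))]
        · refine lintegral_congr fun x => ?_
          dsimp only
          rw [lintegral_const_mul _ hs1, lintegral_indicator_const hs, one_mul]
        · intro y x x' hxx'
          have : h x = h x' := hdep fun j hj => hxx' j (Set.mem_Iic.2 (Set.mem_Iio.1 hj).le)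
          simp only [this])
    refine ⟨π, hπ₁, hπ₂, ?_⟩
    have hbm : ∀ i, Measurable fun p : X i × X i => b i k p.1 p.2 := fun i =>
      (hb_lsc i k).measurable
    have hbm' : ∀ i, Measurable fun p : (∀ j, X j) × (∀ j, X j) => b i k (p.1 i) (p.2 i) :=
      fun i => (hbm i).comp (f := fun p : (∀ j, X j) × (∀ j, X j) => (p.1 i, p.2 i)) (by fun_prop)
    rw [lintegral_finsetSum _ fun i _ => hbm' i]
    calc ∑ i, ∫⁻ p, b i k (p.1 i) (p.2 i) ∂π ≤ ∑ i, (R i + ε) := by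
          refine Finset.sum_le_sum fun i _ => ?_
          rw [hπ₃ i (fun p => b i k p.1 p.2) (hbm i), hκ i (fun p => b i k (p.1 i) p.2)]
          · exact hP₃ i
          · exact (hbm i).comp (f := fun p : (∀ j, X j) × X i => (p.1 i, p.2)) (by fun_prop)
          · intro y x x' hxx'
            simp only [hxx' i (Set.mem_Iic.2 le_rfl)]
      _ ≤ ∑ i, R i + ((k : ℝ≥0∞) + 1)⁻¹ := by
          rw [Finset.sum_add_distrib]
          gcongr
          simp only [Finset.sum_const, Finset.card_univ, Fintype.card_fin, nsmul_eq_mul, ε]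
          calc (n : ℝ≥0∞) * (((k : ℝ≥0∞) + 1)⁻¹ / (n + 1))
              ≤ (n + 1) * (((k : ℝ≥0∞) + 1)⁻¹ / (n + 1)) := by gcongr; exact le_self_add
            _ = ((k : ℝ≥0∞) + 1)⁻¹ := ENNReal.mul_div_cancel (by simp) (by finiteness)
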